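/- Let $C_0>0$. There is a constant $C$, depending only on $C_0$, such that the following holds for every $s\in(1/2,1)$ and every $L>0$. Let $\gamma_0:[0,L]\to S^2\subset\mathbb R^3$ be a closed curve of class $C^2$ (that is, $C^2$ on the circle $[0,L]/\{0,L\}$) without self-intersections and parametrized by arc length, so that $L$ is its length. Let $\nu=\gamma_0\wedge\gamma_0'$ be its normal vector tangent to the sphere (here $\wedge$ is the vector product in $\mathbb R^3$), and set $$k_s(\hat x,\hat y)=\int_0^\infty\frac{\tau\,d\tau}{|\hat x-\tau\hat y|^{3+s}}\qquad(\hat x,\hat y\in S^2).$$ If $$\int_0^L\int_0^L|\nu(t)-\nu(\bar t)|^2\,k_s\big(\gamma_0(t),\gamma_0(\bar t)\big)\,dt\,d\bar t\le C_0L\qquad\text{and}\qquad L\le\frac{C_0}{1-s},$$ then $L\le C$. -/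

import Mathlib

open scoped ENNReal

noncomputable section

namespace NonlocalCurve

/-- Euclidean three-space. -/
abbrev E3 : Type := EuclideanSpace ℝ (Fin 3)

/-- The vector product of Euclidean three-space. -/
def wedge (x y : E3) : E3 := WithLp.toLp 2 (crossProduct (WithLp.ofLp x) (WithLp.ofLp y))

/-- The kernel `k_s(x, y) = ∫_0^∞ t dt / |x - t y|^(3+s)`, with values in `[0, ∞]`
(it equals `∞` on the diagonal of the unit sphere). -/
def kernel (s : ℝ) (x y : E3) : ℝ≥0∞ :=
  ∫⁻ t in Set.Ioi (0 : ℝ), ENNReal.ofReal (t / ‖x - t • y‖ ^ (3 + s))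

/-- `γ` is a closed curve of class `C^2` on the unit sphere, without self-intersections,
parametrized by arc length on `[0, L]`. As a closed `C^2` curve it is a `C^2` map on the circle
`[0, L] / {0, L}`, that is, an `L`-periodic `C^2` map on the line. -/
structure IsSimpleClosedArcLengthCurve (γ : ℝ → E3) (L : ℝ) : Prop where
  pos : 0 < L
  contDiff : ContDiff ℝ 2 γ
  periodic : Function.Periodic γ L
  injOn : Set.InjOn γ (Set.Ico 0 L)
  mem_sphere : ∀ t, γ t ∈ Metric.sphere (0 : E3) 1
  unit_speed : ∀ t, ‖deriv γ t‖ = 1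

/-- The normal vector `ν = γ ∧ γ'`, tangent to the sphere. -/
def normal (γ : ℝ → E3) (t : ℝ) : E3 := wedge (γ t) (deriv γ t)

/-- The integral over `[0, L]` of the squared nonlocal second fundamental form of `γ`,
with values in `[0, ∞]`. -/
def curvatureEnergy (s L : ℝ) (γ : ℝ → E3) : ℝ≥0∞ :=
  ∫⁻ t in Set.Icc 0 L, ∫⁻ u in Set.Icc 0 L,
    ENNReal.ofReal (‖normal γ t - normal γ u‖ ^ 2) * kernel s (γ t) (γ u)

end NonlocalCurve

end

noncomputable section

namespace NonlocalCurve

open MeasureTheory Set Filter Topology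

/-! ### The vector product -/

/-! The kernel is bounded below by `1/64` on the sphere, uniformly in `s`. Since `‖ν(t) - ν(u)‖² = 2
- 2 ν(t)·ν(u)`, the energy is therefore at least `(L² - ‖V‖²) / 32` with `V = ∫ ν`
(`le_curvatureEnergy`). If `‖V‖` is at most a universal constant `K`, the hypothesis gives `L² ≤ 32
C₀ L + K²`, and `L` is bounded.

The vector `V = ∫ γ ∧ γ'` is twice the vector area of the curve. By Stokes it is an integral over an
enclosed region of the sphere, hence bounded. `norm_integral_normal_le` proves this bound without
the Jordan curve theorem, through the potential `W(x) = ∫ det(x, γ, γ') / (‖x‖ - x·γ) dt`. In polar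
coordinates about a unit vector `x` the integrand is `(1 + cos θ) dφ`, whose exterior derivative
away from `x` is minus the area form, whatever `x` is. Hence `W` is locally constant off the cone
over the curve (`windingPotential_eq_of_segment`). Every such `x` can be joined to one of the two
sides of a thin collar of the curve (`exists_windingPotential_eq`), and the jump across the curve is
at most `5 + 16π` (`exists_jump_le`), so `W` has bounded oscillation.

Finally, for fixed `t` the density is a rotated copy of one fixed function, so `∫_B (x·e) W(x) dx =
c V·e` with a universal `c > 0` (`setIntegral_inner_mul_windingPotential`). Taking `e = V` and
subtracting a constant from `W`, which costs nothing because `x·e` is odd, gives `c ‖V‖² ≤ (5 + 16π)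
|B| ‖V‖`. -/

theorem inner_eq (x y : E3) : inner ℝ x y = x 0 * y 0 + x 1 * y 1 + x 2 * y 2 := by
  simp [PiLp.inner_apply, Fin.sum_univ_three]
  ring

theorem wedge_zero (x y : E3) : wedge x y 0 = x 1 * y 2 - x 2 * y 1 := by
  simp [wedge, crossProduct]

theorem wedge_one (x y : E3) : wedge x y 1 = x 2 * y 0 - x 0 * y 2 := by
  simp [wedge, crossProduct]

theorem wedge_two (x y : E3) : wedge x y 2 = x 0 * y 1 - x 1 * y 0 := by
  simp [wedge, crossProduct]

theorem continuous_wedge : Continuous fun p : E3 × E3 => wedge p.1 p.2 := by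
  refine (PiLp.continuous_toLp 2 _).comp (continuous_pi fun i => ?_)
  fin_cases i <;> simp [crossProduct] <;> fun_prop

theorem inner_wedge_self_left (x y : E3) : inner ℝ x (wedge x y) = 0 := by
  simp only [inner_eq, wedge_zero, wedge_one, wedge_two]; ring

theorem inner_wedge_self_right (x y : E3) : inner ℝ y (wedge x y) = 0 := by
  simp only [inner_eq, wedge_zero, wedge_one, wedge_two]; ring

/-- The Plücker relation between four vectors of three-space, paired with a fifth one. -/
theorem inner_wedge_plucker (x h y z w : E3) :
    inner ℝ x w * inner ℝ h (wedge y z) - inner ℝ h w * inner ℝ x (wedge y z)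
      + inner ℝ y w * inner ℝ x (wedge h z) - inner ℝ z w * inner ℝ x (wedge h y) = 0 := by
  simp only [inner_eq, wedge_zero, wedge_one, wedge_two]; ring

theorem norm_wedge_sq (x y : E3) :
    ‖wedge x y‖ ^ 2 = ‖x‖ ^ 2 * ‖y‖ ^ 2 - inner ℝ x y ^ 2 := by
  simp only [← real_inner_self_eq_norm_sq, inner_eq, wedge_zero, wedge_one, wedge_two]; ring

/-! ### Elementary properties of the curve -/

theorem inner_normal (γ : ℝ → E3) (t : ℝ) : inner ℝ (γ t) (normal γ t) = 0 :=
  inner_wedge_self_left _ _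

theorem inner_deriv_normal (γ : ℝ → E3) (t : ℝ) : inner ℝ (deriv γ t) (normal γ t) = 0 :=
  inner_wedge_self_right _ _

namespace IsSimpleClosedArcLengthCurve

variable {γ : ℝ → E3} {L : ℝ}

theorem norm_eq (hγ : IsSimpleClosedArcLengthCurve γ L) (t : ℝ) : ‖γ t‖ = 1 := by
  simpa using hγ.mem_sphere t

theorem inner_self (hγ : IsSimpleClosedArcLengthCurve γ L) (t : ℝ) : inner ℝ (γ t) (γ t) = 1 := by
  rw [real_inner_self_eq_norm_sq, hγ.norm_eq]; norm_num

theorem hasDerivAt (hγ : IsSimpleClosedArcLengthCurve γ L) (t : ℝ) :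
    HasDerivAt γ (deriv γ t) t :=
  (hγ.contDiff.differentiable (by norm_num) t).hasDerivAt

theorem contDiff_deriv (hγ : IsSimpleClosedArcLengthCurve γ L) : ContDiff ℝ 1 (deriv γ) := by
  have := hγ.contDiff
  rw [show (2 : WithTop ℕ∞) = 1 + 1 by norm_num, contDiff_succ_iff_deriv] at this
  exact this.2.2

theorem continuous (hγ : IsSimpleClosedArcLengthCurve γ L) : Continuous γ := hγ.contDiff.continuous

theorem continuous_deriv (hγ : IsSimpleClosedArcLengthCurve γ L) : Continuous (deriv γ) :=
  hγ.contDiff_deriv.continuous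

theorem continuous_normal (hγ : IsSimpleClosedArcLengthCurve γ L) : Continuous (normal γ) :=
  continuous_wedge.comp (hγ.continuous.prodMk hγ.continuous_deriv)

theorem inner_deriv (hγ : IsSimpleClosedArcLengthCurve γ L) (t : ℝ) :
    inner ℝ (γ t) (deriv γ t) = 0 := by
  have h1 : HasDerivAt (fun u => inner ℝ (γ u) (γ u)) _ t :=
    (hγ.hasDerivAt t).inner ℝ (hγ.hasDerivAt t)
  have h2 : HasDerivAt (fun u => inner ℝ (γ u) (γ u)) 0 t := by
    simp_rw [hγ.inner_self]; exact hasDerivAt_const t (1 : ℝ)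
  have := h1.unique h2
  rw [real_inner_comm (γ t) (deriv γ t)] at this
  linarith

theorem norm_normal (hγ : IsSimpleClosedArcLengthCurve γ L) (t : ℝ) : ‖normal γ t‖ = 1 := by
  have := norm_wedge_sq (γ t) (deriv γ t)
  rw [hγ.norm_eq, hγ.unit_speed, hγ.inner_deriv] at this
  have h : ‖normal γ t‖ ^ 2 = 1 := by rw [normal, this]; norm_num
  nlinarith [norm_nonneg (normal γ t)]

theorem periodic_deriv (hγ : IsSimpleClosedArcLengthCurve γ L) :
    Function.Periodic (deriv γ) L := by
  intro t
  rw [← deriv_comp_add_const]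
  congr 1
  exact funext hγ.periodic

theorem periodic_normal (hγ : IsSimpleClosedArcLengthCurve γ L) :
    Function.Periodic (normal γ) L := by
  intro t
  simp only [normal, hγ.periodic t, hγ.periodic_deriv t]

theorem orthonormal (hγ : IsSimpleClosedArcLengthCurve γ L) (t : ℝ) :
    Orthonormal ℝ ![γ t, deriv γ t, normal γ t] := by
  rw [orthonormal_iff_ite]
  intro i j
  have h1 := hγ.inner_deriv t
  have h2 := inner_normal γ t
  have h3 := inner_deriv_normal γ t
  fin_cases i <;> fin_cases j <;>
    simp [h1, h2, h3, hγ.norm_eq t, hγ.unit_speed t, hγ.norm_normal t,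
      real_inner_comm (γ t), real_inner_comm (deriv γ t) (normal γ t)]

/-- The moving frame of the curve. -/
theorem exists_frame (hγ : IsSimpleClosedArcLengthCurve γ L) (t : ℝ) :
    ∃ b : OrthonormalBasis (Fin 3) ℝ E3, b 0 = γ t ∧ b 1 = deriv γ t ∧ b 2 = normal γ t := by
  have h := hγ.orthonormal t
  let b := (basisOfOrthonormalOfCardEqFinrank h (by simp)).toOrthonormalBasis (by
    simpa using h)
  refine ⟨b, ?_, ?_, ?_⟩ <;> simp [b]

theorem ne_of_lt (hγ : IsSimpleClosedArcLengthCurve γ L) {a b : ℝ} (hab : a < b)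
    (hb : b < a + L) : γ a ≠ γ b := by
  intro h
  have key : ∀ c, ∃ n : ℤ, c - n * L ∈ Ico 0 L ∧ γ c = γ (c - n * L) := fun c =>
    ⟨toIcoDiv hγ.pos 0 c, by
      have := sub_toIcoDiv_zsmul_mem_Ico hγ.pos 0 c
      simpa using this, by rw [← zsmul_eq_mul, hγ.periodic.sub_zsmul_eq]⟩
  obtain ⟨n, hn, hn'⟩ := key a
  obtain ⟨m, hm, hm'⟩ := key b
  have e := hγ.injOn hn hm (by rw [← hn', ← hm', h])
  have e2 : b - a = ((m - n : ℤ) : ℝ) * L := by push_cast; linarith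
  have hL := hγ.pos
  have l1 : (0 : ℝ) < ((m - n : ℤ) : ℝ) := by
    by_contra hc
    nlinarith
  have l2 : ((m - n : ℤ) : ℝ) < 1 := by
    by_contra hc
    nlinarith
  have l1' : 0 < m - n := by exact_mod_cast l1
  have l2' : m - n < 1 := by exact_mod_cast l2
  omega

/-- `γ''` is continuous and periodic, hence bounded. The constant depends on the curve, but only
serves to choose scales and drops out of the final bound. -/
theorem exists_lipschitz (hγ : IsSimpleClosedArcLengthCurve γ L) :
    ∃ M : ℝ, 1 ≤ M ∧ ∀ t u, ‖deriv γ u - deriv γ t‖ ≤ M * |u - t| := by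
  have hc : Continuous (deriv (deriv γ)) := hγ.contDiff_deriv.continuous_deriv_one
  have hp : Function.Periodic (deriv (deriv γ)) L := by
    intro t
    rw [← deriv_comp_add_const]
    congr 1
    exact funext hγ.periodic_deriv
  obtain ⟨M, hM⟩ := isCompact_Icc.exists_bound_of_continuousOn
    (s := Icc 0 L) hc.continuousOn
  refine ⟨max M 1, le_max_right _ _, fun t u => ?_⟩
  have hb : ∀ t, ‖deriv (deriv γ) t‖ ≤ max M 1 := fun t => by
    obtain ⟨y, hy, e⟩ := hp.exists_mem_Ico₀ hγ.pos t
    rw [e]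
    exact (hM y (Ico_subset_Icc_self hy)).trans (le_max_left _ _)
  have := convex_univ.norm_image_sub_le_of_norm_deriv_le (𝕜 := ℝ) (f := deriv γ) (x := t) (y := u)
    (fun x _ => (hγ.contDiff_deriv.differentiable (by norm_num)) x) (fun x _ => hb x)
    (mem_univ _) (mem_univ _)
  simpa [Real.norm_eq_abs] using this

theorem taylor (hγ : IsSimpleClosedArcLengthCurve γ L) {M : ℝ} (hM1 : 1 ≤ M)
    (hM : ∀ t u, ‖deriv γ u - deriv γ t‖ ≤ M * |u - t|) (t u : ℝ) :
    ‖γ u - γ t - (u - t) • deriv γ t‖ ≤ M * (u - t) ^ 2 := by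
  have hd : ∀ x, HasDerivAt (fun u => γ u - (u - t) • deriv γ t)
      (deriv γ x - (1 : ℝ) • deriv γ t) x := fun x =>
    (hγ.hasDerivAt x).sub (((hasDerivAt_id x).sub_const t).smul_const (deriv γ t))
  have := (convex_uIcc t u).norm_image_sub_le_of_norm_hasDerivWithin_le (𝕜 := ℝ)
    (f := fun u => γ u - (u - t) • deriv γ t) (x := t) (y := u) (C := M * |u - t|)
    (fun x _ => (hd x).hasDerivWithinAt) (fun x hx => ?_) left_mem_uIcc right_mem_uIcc
  · have e : γ u - (u - t) • deriv γ t - (γ t - (t - t) • deriv γ t)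
        = γ u - γ t - (u - t) • deriv γ t := by rw [sub_self, zero_smul]; abel
    simp only [e, Real.norm_eq_abs] at this
    calc _ ≤ _ := this
      _ = M * (u - t) ^ 2 := by rw [mul_assoc, abs_mul_abs_self]; ring
  · rw [one_smul]
    refine (hM t x).trans ?_
    have : |x - t| ≤ |u - t| := abs_sub_left_of_mem_uIcc hx
    gcongr

end IsSimpleClosedArcLengthCurve

/-! ### The winding potential -/

/-- `x` does not lie on the cone over the curve. -/
def OffCone (γ : ℝ → E3) (x : E3) : Prop := ∀ t, inner ℝ x (γ t) < ‖x‖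

theorem OffCone.ne_zero {γ : ℝ → E3} {x : E3} (hx : OffCone γ x) : x ≠ 0 := fun e => by
  have := hx 0
  simp [e] at this

/-- The integrand of the winding potential. -/
def windingDensity (γ : ℝ → E3) (x : E3) (t : ℝ) : ℝ :=
  inner ℝ x (normal γ t) / (‖x‖ - inner ℝ x (γ t))

/-- The winding potential of a closed spherical curve: up to an additive constant and a factor
`4π`, it is the winding number of the curve around the ray through `x`. -/
def windingPotential (γ : ℝ → E3) (L : ℝ) (x : E3) : ℝ := ∫ t in 0..L, windingDensity γ x t

theorem windingDensity_smul (γ : ℝ → E3) {c : ℝ} (hc : 0 < c) (x : E3) (t : ℝ) :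
    windingDensity γ (c • x) t = windingDensity γ x t := by
  simp only [windingDensity, inner_smul_left, norm_smul, Real.norm_of_nonneg hc.le,
    RCLike.conj_to_real]
  rw [← mul_sub, mul_div_mul_left _ _ hc.ne']

theorem windingPotential_smul (γ : ℝ → E3) (L : ℝ) {c : ℝ} (hc : 0 < c) (x : E3) :
    windingPotential γ L (c • x) = windingPotential γ L x := by
  simp only [windingPotential, windingDensity_smul γ hc]

/-- The derivative in direction `h` of the winding density at `x`, which is also the derivative
along the curve of `det (x, h, γ) / (‖x‖ (‖x‖ - x · γ))`. -/
def windingVariation (γ : ℝ → E3) (h x : E3) (t : ℝ) : ℝ :=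
  (inner ℝ x (wedge h (deriv γ t)) * (‖x‖ - inner ℝ x (γ t))
    + inner ℝ x (wedge h (γ t)) * inner ℝ x (deriv γ t)) / (‖x‖ * (‖x‖ - inner ℝ x (γ t)) ^ 2)

theorem hasDerivAt_inner_wedge (x h : E3) {f : ℝ → E3} {f' : E3} {t : ℝ}
    (hf : HasDerivAt f f' t) :
    HasDerivAt (fun u => inner ℝ x (wedge h (f u))) (inner ℝ x (wedge h f')) t := by
  have e : ∀ z, inner ℝ x (wedge h z) = inner ℝ (wedge x h) z := fun z => by
    simp only [inner_eq, wedge_zero, wedge_one, wedge_two]; ring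
  simp only [e]
  simpa using (hasDerivAt_const t (wedge x h)).inner ℝ hf

namespace IsSimpleClosedArcLengthCurve

variable {γ : ℝ → E3} {L : ℝ}

/-- With `hasDerivAt_along_line`, this shows that the `x`-derivative of the density is a total
derivative along the curve, so that it integrates to zero over a period. -/
theorem hasDerivAt_along_curve (hγ : IsSimpleClosedArcLengthCurve γ L) (h : E3) {x : E3} (t : ℝ)
    (hx : inner ℝ x (γ t) < ‖x‖) (hx0 : x ≠ 0) :
    HasDerivAt (fun u => inner ℝ x (wedge h (γ u)) / (‖x‖ * (‖x‖ - inner ℝ x (γ u))))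
      (windingVariation γ h x t) t := by
  have hn : ‖x‖ ≠ 0 := norm_ne_zero_iff.2 hx0
  have hD : ‖x‖ - inner ℝ x (γ t) ≠ 0 := (sub_pos.2 hx).ne'
  have h1 := hasDerivAt_inner_wedge x h (hγ.hasDerivAt t)
  have h2 : HasDerivAt (fun u => inner ℝ x (γ u)) (inner ℝ x (deriv γ t)) t := by
    simpa using (hasDerivAt_const t x).inner ℝ (hγ.hasDerivAt t)
  refine (h1.div ((h2.const_sub ‖x‖).const_mul ‖x‖) (mul_ne_zero hn hD)).congr_deriv ?_
  rw [windingVariation]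
  field_simp
  ring

theorem hasDerivAt_along_line (hγ : IsSimpleClosedArcLengthCurve γ L) (x₀ h : E3) (l t : ℝ)
    (hx : inner ℝ (x₀ + l • h) (γ t) < ‖x₀ + l • h‖) (hx0 : x₀ + l • h ≠ 0) :
    HasDerivAt (fun l => windingDensity γ (x₀ + l • h) t)
      (windingVariation γ h (x₀ + l • h) t) l := by
  have hn : ‖x₀ + l • h‖ ≠ 0 := norm_ne_zero_iff.2 hx0
  have hD : ‖x₀ + l • h‖ - inner ℝ (x₀ + l • h) (γ t) ≠ 0 := (sub_pos.2 hx).ne'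
  have h0 : HasDerivAt (fun l : ℝ => x₀ + l • h) h l := by
    simpa using ((hasDerivAt_id l).smul_const h).const_add x₀
  have h1 : ∀ z : E3, HasDerivAt (fun l : ℝ => inner ℝ (x₀ + l • h) z) (inner ℝ h z) l :=
    fun z => by simpa using h0.inner ℝ (hasDerivAt_const l z)
  have h2 : HasDerivAt (fun l : ℝ => ‖x₀ + l • h‖) (inner ℝ (x₀ + l • h) h / ‖x₀ + l • h‖) l := by
    have h3 := (h0.norm_sq).sqrt (pow_ne_zero 2 hn)
    simp only [Real.sqrt_sq (norm_nonneg _)] at h3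
    convert h3 using 1
    field_simp
  have h4 := (h1 (normal γ t)).div (h2.sub (h1 (γ t))) hD
  refine h4.congr_deriv ?_
  simp only [Pi.sub_apply]
  generalize x₀ + l • h = x at *
  -- Clearing denominators leaves a polynomial identity between determinants of `x, h, γ, γ'`; it is
  -- the linear dependence of these four vectors, paired with `γ` and with `x`.
  have p1 := inner_wedge_plucker x h (γ t) (deriv γ t) (γ t)
  have p2 := inner_wedge_plucker x h (γ t) (deriv γ t) x
  rw [hγ.inner_self, real_inner_comm (γ t) (deriv γ t), hγ.inner_deriv] at p1
  rw [real_inner_self_eq_norm_sq, real_inner_comm x h, real_inner_comm x (γ t),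
    real_inner_comm x (deriv γ t)] at p2
  rw [windingVariation, normal]
  field_simp
  linear_combination p2 - ‖x‖ * p1

theorem continuous_windingDensity (hγ : IsSimpleClosedArcLengthCurve γ L) {x : E3}
    (hx : OffCone γ x) : Continuous (windingDensity γ x) := by
  have hγc := hγ.continuous
  have hνc := hγ.continuous_normal
  unfold windingDensity
  exact Continuous.div (by fun_prop) (by fun_prop) fun t => (sub_pos.2 (hx t)).ne'

theorem continuousOn_windingVariation (hγ : IsSimpleClosedArcLengthCurve γ L) (h : E3) :
    ContinuousOn (fun p : E3 × ℝ => windingVariation γ h p.1 p.2) ({x | OffCone γ x} ×ˢ univ) := by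
  have hγc := hγ.continuous
  have hγd := hγ.continuous_deriv
  have c1 : Continuous fun p : E3 × ℝ => wedge h (deriv γ p.2) :=
    continuous_wedge.comp (continuous_const.prodMk (hγd.comp continuous_snd))
  have c2 : Continuous fun p : E3 × ℝ => wedge h (γ p.2) :=
    continuous_wedge.comp (continuous_const.prodMk (hγc.comp continuous_snd))
  simp only [windingVariation]
  refine ContinuousOn.div (by fun_prop) (by fun_prop) ?_
  rintro ⟨x, t⟩ ⟨hx, -⟩
  exact mul_ne_zero (norm_ne_zero_iff.2 hx.ne_zero) (pow_ne_zero 2 (sub_pos.2 (hx t)).ne')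

theorem windingDensity_sub (hγ : IsSimpleClosedArcLengthCurve γ L) (x₀ h : E3)
    (hoff : ∀ l ∈ Icc (0 : ℝ) 1, OffCone γ (x₀ + l • h)) (t : ℝ) :
    windingDensity γ (x₀ + h) t - windingDensity γ x₀ t
      = ∫ l in (0 : ℝ)..1, windingVariation γ h (x₀ + l • h) t := by
  rw [intervalIntegral.integral_eq_sub_of_hasDerivAt
    (f := fun l => windingDensity γ (x₀ + l • h) t)]
  · simp
  · intro l hl
    rw [uIcc_of_le zero_le_one] at hl
    exact hγ.hasDerivAt_along_line x₀ h l t (hoff l hl t) (hoff l hl).ne_zero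
  · apply ContinuousOn.intervalIntegrable
    rw [uIcc_of_le zero_le_one]
    have c : ContinuousOn (fun l : ℝ => (x₀ + l • h, t)) (Icc 0 1) := by fun_prop
    have m : MapsTo (fun l : ℝ => (x₀ + l • h, t)) (Icc 0 1) ({x | OffCone γ x} ×ˢ univ) :=
      fun l hl => mk_mem_prod (hoff l hl) (mem_univ t)
    have := (hγ.continuousOn_windingVariation h).comp c m
    simpa only [Function.comp_def] using this

theorem integral_windingVariation (hγ : IsSimpleClosedArcLengthCurve γ L) (h : E3) {x : E3}
    (hx : OffCone γ x) : ∫ t in (0 : ℝ)..L, windingVariation γ h x t = 0 := by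
  rw [intervalIntegral.integral_eq_sub_of_hasDerivAt
    (fun t _ => hγ.hasDerivAt_along_curve h t (hx t) hx.ne_zero)]
  · have := hγ.periodic 0
    rw [zero_add] at this
    simp [this]
  · apply Continuous.intervalIntegrable
    rw [← continuousOn_univ]
    have c : ContinuousOn (fun t : ℝ => (x, t)) univ := by fun_prop
    have m : MapsTo (fun t : ℝ => (x, t)) univ ({x | OffCone γ x} ×ˢ univ) :=
      fun t _ => mk_mem_prod hx (mem_univ t)
    have := (hγ.continuousOn_windingVariation h).comp c m
    simpa only [Function.comp_def] using this

/-- The winding potential is constant along segments that avoid the cone over the curve. -/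
theorem windingPotential_eq_of_segment (hγ : IsSimpleClosedArcLengthCurve γ L) (x₀ h : E3)
    (hoff : ∀ l ∈ Icc (0 : ℝ) 1, OffCone γ (x₀ + l • h)) :
    windingPotential γ L (x₀ + h) = windingPotential γ L x₀ := by
  have i1 := (hγ.continuous_windingDensity (hoff 1 (by simp))).intervalIntegrable
    (μ := volume) 0 L
  have i0 := (hγ.continuous_windingDensity (hoff 0 (by simp))).intervalIntegrable
    (μ := volume) 0 L
  simp only [one_smul, zero_smul, add_zero] at i1 i0
  rw [← sub_eq_zero, windingPotential, windingPotential, ← intervalIntegral.integral_sub i1 i0]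
  simp only [hγ.windingDensity_sub x₀ h hoff]
  -- Exchanging the integrals leaves, for each point of the segment, the integral of an exact
  -- derivative over the closed curve.
  rw [intervalIntegral_intervalIntegral_swap]
  · apply intervalIntegral.integral_zero_ae
    refine Eventually.of_forall fun l hl => ?_
    rw [uIoc_of_le zero_le_one] at hl
    exact hγ.integral_windingVariation h (hoff l (Ioc_subset_Icc_self hl))
  · have hc : ContinuousOn (fun p : ℝ × ℝ => windingVariation γ h (x₀ + p.2 • h) p.1)
        (Icc 0 L ×ˢ Icc 0 1) := by
      have c : ContinuousOn (fun p : ℝ × ℝ => (x₀ + p.2 • h, p.1)) (Icc 0 L ×ˢ Icc 0 1) := by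
        fun_prop
      have m : MapsTo (fun p : ℝ × ℝ => (x₀ + p.2 • h, p.1)) (Icc 0 L ×ˢ Icc 0 1)
          ({x | OffCone γ x} ×ˢ univ) := fun p hp => mk_mem_prod (hoff _ hp.2) (mem_univ p.1)
      have := (hγ.continuousOn_windingVariation h).comp c m
      simpa only [Function.comp_def] using this
    have hi := hc.integrableOn_compact (μ := volume) (isCompact_Icc.prod isCompact_Icc)
    rw [uIoc_of_le hγ.pos.le, uIoc_of_le zero_le_one]
    exact hi.mono_set (prod_mono Ioc_subset_Icc_self Ioc_subset_Icc_self)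

end IsSimpleClosedArcLengthCurve

/-! ### The winding potential takes two values -/

namespace IsSimpleClosedArcLengthCurve

variable {γ : ℝ → E3} {L : ℝ}

theorem exists_isMaxOn (hγ : IsSimpleClosedArcLengthCurve γ L) (x : E3) :
    ∃ t, ∀ u, inner ℝ x (γ u) ≤ inner ℝ x (γ t) := by
  have hγc := hγ.continuous
  obtain ⟨t, -, ht⟩ := isCompact_Icc.exists_isMaxOn (nonempty_Icc.2 hγ.pos.le)
    (f := fun t => inner ℝ x (γ t)) (by fun_prop)
  refine ⟨t, fun u => ?_⟩
  obtain ⟨y, hy, e⟩ := hγ.periodic.exists_mem_Ico₀ hγ.pos u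
  rw [e]
  exact ht (Ico_subset_Icc_self hy)

/-- A displacement of size `r` lowers `‖x‖` and raises `x·γ` by at most `r` each, so half of the
smallest gap is an admissible radius. -/
theorem eventually_offCone (hγ : IsSimpleClosedArcLengthCurve γ L) {x : E3} (hx : OffCone γ x) :
    ∃ r > 0, ∀ y, ‖y - x‖ < r → OffCone γ y := by
  obtain ⟨t, ht⟩ := hγ.exists_isMaxOn x
  have hp := sub_pos.2 (hx t)
  refine ⟨(‖x‖ - inner ℝ x (γ t)) / 2, by positivity, fun y hy u => ?_⟩
  have h1 : inner ℝ y (γ u) = inner ℝ x (γ u) + inner ℝ (y - x) (γ u) := by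
    rw [← inner_add_left]; congr 1; abel
  have h2 : inner ℝ (y - x) (γ u) ≤ ‖y - x‖ := by
    simpa [hγ.norm_eq u] using real_inner_le_norm (y - x) (γ u)
  have h3 : ‖x‖ ≤ ‖y‖ + ‖y - x‖ := by
    have := norm_sub_le y (y - x)
    simpa using this
  linarith [ht u]

theorem eventually_windingPotential_eq (hγ : IsSimpleClosedArcLengthCurve γ L) {x : E3}
    (hx : OffCone γ x) : ∀ᶠ y in 𝓝 x, windingPotential γ L y = windingPotential γ L x := by
  obtain ⟨r, hr, h⟩ := hγ.eventually_offCone hx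
  filter_upwards [Metric.ball_mem_nhds x hr] with y hy
  rw [mem_ball_iff_norm] at hy
  have := hγ.windingPotential_eq_of_segment x (y - x) fun l hl => h _ ?_
  · simpa using this
  · rw [add_sub_cancel_left, norm_smul, Real.norm_of_nonneg hl.1]
    exact (mul_le_of_le_one_left (norm_nonneg _) hl.2).trans_lt hy

theorem windingPotential_eq_of_path (hγ : IsSimpleClosedArcLengthCurve γ L) {c : ℝ → E3}
    (hc : Continuous c) (hoff : ∀ t, OffCone γ (c t)) (t u : ℝ) :
    windingPotential γ L (c t) = windingPotential γ L (c u) := by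
  have : IsLocallyConstant fun t => windingPotential γ L (c t) := by
    rw [IsLocallyConstant.iff_eventually_eq]
    exact fun t => hc.continuousAt.eventually (hγ.eventually_windingPotential_eq (hoff t))
  exact this.apply_eq_of_preconnectedSpace t u

/-! ### The collar of the curve and its two sides -/

theorem norm_collar_sq (hγ : IsSimpleClosedArcLengthCurve γ L) (t a b : ℝ) :
    ‖a • γ t + b • normal γ t‖ ^ 2 = a ^ 2 + b ^ 2 := by
  rw [norm_add_sq_real, norm_smul, norm_smul, inner_smul_left, inner_smul_right, inner_normal,
    hγ.norm_eq, hγ.norm_normal]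
  simp

theorem eq_smul_of_norm_le_inner (hγ : IsSimpleClosedArcLengthCurve γ L) {x : E3} {u : ℝ}
    (h : ‖x‖ ≤ inner ℝ x (γ u)) : x = ‖x‖ • γ u := by
  rw [← sub_eq_zero, ← norm_eq_zero, ← sq_eq_zero_iff]
  refine le_antisymm ?_ (sq_nonneg _)
  rw [norm_sub_sq_real, norm_smul, inner_smul_right, hγ.norm_eq, norm_norm]
  nlinarith [norm_nonneg x]

/-- Distinct sheets of the curve stay apart. -/
theorem exists_separation (hγ : IsSimpleClosedArcLengthCurve γ L) {δ : ℝ} (hδ : 0 < δ) :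
    ∃ m > 0, ∀ t, ∀ v ∈ Icc δ (L - δ), m ≤ ‖γ (t + v) - γ t‖ := by
  have hγc := hγ.continuous
  rcases (Icc δ (L - δ)).eq_empty_or_nonempty with he | hne
  · exact ⟨1, one_pos, fun t v hv => by simp [he] at hv⟩
  · obtain ⟨p, hp, hmin⟩ := (isCompact_Icc.prod isCompact_Icc).exists_isMinOn
      ((nonempty_Icc.2 hγ.pos.le).prod hne) (f := fun p : ℝ × ℝ => ‖γ (p.1 + p.2) - γ p.1‖)
      (by fun_prop)
    refine ⟨‖γ (p.1 + p.2) - γ p.1‖, norm_pos_iff.2 (sub_ne_zero.2 ?_), fun t v hv => ?_⟩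
    · exact (hγ.ne_of_lt (by linarith [hp.2.1]) (by linarith [hp.2.2])).symm
    · have hper : Function.Periodic (fun t => ‖γ (t + v) - γ t‖) L := fun t => by
        simp only [add_right_comm t L v, hγ.periodic _]
      obtain ⟨y, hy, e⟩ := hper.exists_mem_Ico₀ hγ.pos t
      rw [e]
      have hm : (y, v) ∈ Icc 0 L ×ˢ Icc δ (L - δ) := mk_mem_prod (Ico_subset_Icc_self hy) hv
      exact isMinOn_iff.1 hmin (y, v) hm

/-- A one-parameter collar of the curve avoids the cone over the curve. -/
theorem exists_collar (hγ : IsSimpleClosedArcLengthCurve γ L) :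
    ∃ ε₀ > 0, ∀ ε : ℝ, ε ≠ 0 → |ε| < ε₀ → ∀ t, OffCone γ (γ t + ε • normal γ t) := by
  obtain ⟨M, hM1, hM⟩ := hγ.exists_lipschitz
  have hM0 : 0 < M := by linarith
  obtain ⟨m, hm, hsep⟩ := hγ.exists_separation (δ := 1 / (2 * M)) (by positivity)
  refine ⟨m / 2, by positivity, fun ε hε hε' t u => ?_⟩
  by_contra hcon
  push Not at hcon
  have hper := hγ.periodic
  -- This choice of period makes the far case below fall exactly in the range of the separation
  -- constant `m`.
  obtain ⟨v, hv, e⟩ := hper.exists_mem_Ico hγ.pos u (t - 1 / (2 * M))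
  rw [e] at hcon
  have hx := hγ.eq_smul_of_norm_le_inner hcon
  have hn := hγ.norm_collar_sq t 1 ε
  rw [one_smul] at hn
  set ρ := ‖γ t + ε • normal γ t‖ with hρ
  have hρ1 : 1 ≤ ρ := by nlinarith [norm_nonneg (γ t + ε • normal γ t), sq_nonneg ε]
  rcases le_or_gt v (t + 1 / (2 * M)) with hnear | hfar
  -- Near sheet: `γ'(t)·γ(v)` vanishes, yet equals `v - t` up to `M (v - t)²`. This forces `v = t`,
  -- and then the normal component gives `ε = 0`.
  · have h1 : inner ℝ (deriv γ t) (γ v) = 0 := by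
      have h := congrArg (fun z => inner ℝ (deriv γ t) z) hx
      simp only [inner_add_right, inner_smul_right, inner_deriv_normal, mul_zero, add_zero] at h
      rw [real_inner_comm, hγ.inner_deriv] at h
      rcases mul_eq_zero.1 h.symm with h | h
      · linarith
      · exact h
    have h2 := hγ.taylor hM1 hM t v
    have h3 : inner ℝ (deriv γ t) (γ v - γ t - (v - t) • deriv γ t) = -(v - t) := by
      rw [inner_sub_right, inner_sub_right, h1, inner_smul_right, real_inner_comm,
        hγ.inner_deriv, real_inner_self_eq_norm_sq, hγ.unit_speed]
      ring
    have h4 := abs_real_inner_le_norm (deriv γ t) (γ v - γ t - (v - t) • deriv γ t)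
    rw [h3, hγ.unit_speed, one_mul, abs_neg] at h4
    have h5 : |v - t| ≤ 1 / (2 * M) := abs_le.2 ⟨by linarith [hv.1], by linarith⟩
    have h6 : |v - t| ≤ M * |v - t| ^ 2 := by rw [sq_abs]; linarith
    have h7 : M * |v - t| ≤ 1 / 2 := by
      calc M * |v - t| ≤ M * (1 / (2 * M)) := by gcongr
        _ = 1 / 2 := by field_simp
    have h8 : |v - t| = 0 := by nlinarith [abs_nonneg (v - t)]
    have h9 : v = t := by rwa [abs_eq_zero, sub_eq_zero] at h8
    have h := congrArg (fun z => inner ℝ (normal γ t) z) hx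
    simp only [h9, inner_add_right, inner_smul_right] at h
    rw [real_inner_comm, inner_normal, real_inner_self_eq_norm_sq, hγ.norm_normal] at h
    apply hε
    linarith
  -- Far sheet: `γ(v)·γ(t) = 1/ρ ≥ 1 - ε²` would bring `γ(v)` closer to `γ(t)` than `m`.
  · have h1 := hsep t (v - t) ⟨by linarith, by linarith [hv.2]⟩
    rw [add_sub_cancel] at h1
    have h2 : ρ * inner ℝ (γ v) (γ t) = 1 := by
      have : ρ * inner ℝ (γ v) (γ t) = inner ℝ (ρ • γ v) (γ t) := by simp [inner_smul_left]
      rw [this, ← hx, inner_add_left, inner_smul_left,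
        real_inner_comm (γ t) (normal γ t), inner_normal, hγ.inner_self]
      simp
    have h3 : ‖γ v - γ t‖ ^ 2 = 2 - 2 * inner ℝ (γ v) (γ t) := by
      rw [norm_sub_sq_real, hγ.norm_eq, hγ.norm_eq]; ring
    have h4 : m ^ 2 ≤ ‖γ v - γ t‖ ^ 2 := by gcongr
    have h5 : ε ^ 2 < (m / 2) ^ 2 := by rw [← sq_abs]; gcongr
    have h6 : 1 - ε ^ 2 ≤ inner ℝ (γ v) (γ t) := by
      set w := inner ℝ (γ v) (γ t)
      have : 0 < w := by nlinarith
      have hw : (1 + ε ^ 2) * w = ρ := by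
        have : ρ ^ 2 * w = ρ * (ρ * w) := by ring
        rw [h2, hn] at this
        linarith
      have hw1 : w ≤ 1 := by nlinarith
      nlinarith [sq_nonneg ε]
    nlinarith

theorem windingPotential_collar (hγ : IsSimpleClosedArcLengthCurve γ L) {ε₀ : ℝ}
    (hcol : ∀ ε, ε ≠ 0 → |ε| < ε₀ → ∀ t, OffCone γ (γ t + ε • normal γ t))
    {ε η : ℝ} (hε : |ε| < ε₀) (hη : |η| < ε₀) (hεη : 0 < ε * η) (t u : ℝ) :
    windingPotential γ L (γ t + ε • normal γ t) = windingPotential γ L (γ u + η • normal γ u) := by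
  have hγc := hγ.continuous
  have hνc := hγ.continuous_normal
  have hε0 : ε ≠ 0 := fun e => by simp [e] at hεη
  rw [hγ.windingPotential_eq_of_path (c := fun t => γ t + ε • normal γ t) (by fun_prop)
    (hcol ε hε0 hε) t u]
  have := hγ.windingPotential_eq_of_segment (γ u + ε • normal γ u) ((η - ε) • normal γ u)
    fun l hl => ?_
  · rw [← this]
    congr 1
    rw [add_assoc, ← add_smul, add_sub_cancel]
  · rw [add_assoc, smul_smul, ← add_smul]
    obtain ⟨h1, h2⟩ := abs_lt.1 hε
    obtain ⟨h3, h4⟩ := abs_lt.1 hη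
    obtain ⟨h5, h6⟩ := hl
    refine hcol _ ?_ (abs_lt.2 ?_) u
    · have : 0 < (ε + l * (η - ε)) * ε := by
        have : 0 < ε ^ 2 := by positivity
        have e : (ε + l * (η - ε)) * ε = (1 - l) * ε ^ 2 + l * (ε * η) := by ring
        rw [e]
        rcases h5.eq_or_lt with h | h
        · rw [← h]; linarith
        · have := mul_pos h hεη
          have := mul_nonneg (sub_nonneg.2 h6) (sq_nonneg ε)
          linarith
      exact left_ne_zero_of_mul this.ne'
    · have := convex_Ioo (-ε₀) ε₀ ⟨h1, h2⟩ ⟨h3, h4⟩ (sub_nonneg.2 h6) h5 (by ring)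
      have e : ε + l * (η - ε) = (1 - l) • ε + l • η := by simp only [smul_eq_mul]; ring
      rw [e]
      exact this

/-- Off the cone, the winding potential agrees with its value near the closest point of the
curve, on one of the two sides. -/
theorem exists_windingPotential_eq (hγ : IsSimpleClosedArcLengthCurve γ L) {x : E3}
    (hx : OffCone γ x) : ∃ t β η : ℝ, β ≠ 0 ∧ 0 < η ∧ ∀ ε, 0 < ε * β → |ε| < η →
      windingPotential γ L x = windingPotential γ L (γ t + ε • normal γ t) := by
  obtain ⟨t, ht⟩ := hγ.exists_isMaxOn x
  have hx0 : 0 < ‖x‖ := norm_pos_iff.2 hx.ne_zero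
  have hd : inner ℝ x (deriv γ t) = 0 := by
    have h2 : HasDerivAt (fun u => inner ℝ x (γ u)) (inner ℝ x (deriv γ t)) t := by
      simpa using (hasDerivAt_const t x).inner ℝ (hγ.hasDerivAt t)
    exact IsLocalMax.hasDerivAt_eq_zero (Eventually.of_forall ht) h2
  obtain ⟨b, hb0, hb1, hb2⟩ := hγ.exists_frame t
  have hdec : x = inner ℝ x (γ t) • γ t + inner ℝ x (normal γ t) • normal γ t := by
    have := b.sum_repr' x
    rw [Fin.sum_univ_three, hb0, hb1, hb2] at this
    rw [real_inner_comm, real_inner_comm x (deriv γ t), hd,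
      real_inner_comm x (normal γ t)] at this
    simpa using this.symm
  set α := inner ℝ x (γ t) with hα
  set β := inner ℝ x (normal γ t) with hβ
  have hn : ‖x‖ ^ 2 = α ^ 2 + β ^ 2 := by
    conv_lhs => rw [hdec]
    exact hγ.norm_collar_sq t α β
  -- If `β = 0`, then `x·γ` has maximum `-‖x‖`, its least possible value, so the curve would be
  -- constant.
  have hβ0 : β ≠ 0 := by
    intro h0
    have h1 : α < ‖x‖ := hx t
    have h2 : α = -‖x‖ := by
      have : (α - ‖x‖) * (α + ‖x‖) = 0 := by rw [h0] at hn; linarith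
      rcases mul_eq_zero.1 this with h | h <;> linarith
    have h3 : ∀ u, -x = ‖x‖ • γ u := fun u => by
      have := hγ.eq_smul_of_norm_le_inner (x := -x) (u := u)
        (by rw [norm_neg, inner_neg_left]; linarith [ht u])
      rwa [norm_neg] at this
    have h4 : γ 0 = γ (L / 2) := smul_right_injective _ hx0.ne' ((h3 0).symm.trans (h3 (L / 2)))
    exact hγ.ne_of_lt (by linarith [hγ.pos]) (by linarith [hγ.pos]) h4
  -- The bound on `|ε|` gives `β / ε ≥ α`, so that moving from `x` in the direction `γ t` reaches a
  -- positive multiple of `γ t + ε • normal γ t`.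
  refine ⟨t, β, |β| / (|α| + 1), hβ0, by positivity, fun ε hεβ hε => ?_⟩
  have hε0 : ε ≠ 0 := fun e => by simp [e] at hεβ
  have hc : 0 < β / ε := by
    have : β / ε = ε * β / ε ^ 2 := by field_simp
    rw [this]; positivity
  have hle : α ≤ β / ε := by
    rw [lt_div_iff₀ (by positivity)] at hε
    rw [← abs_of_pos hc, abs_div, le_div_iff₀ (abs_pos.2 hε0)]
    nlinarith [le_abs_self α, abs_nonneg ε]
  rw [← windingPotential_smul γ L hc (γ t + ε • normal γ t)]
  have e : (β / ε) • (γ t + ε • normal γ t) = x + (β / ε - α) • γ t := by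
    conv_rhs => rw [hdec]
    rw [smul_add, smul_smul, div_mul_cancel₀ _ hε0, sub_smul]
    abel
  rw [e]
  -- Along this segment maximality at `t` bounds the inner product with any `γ u` by the coefficient
  -- of `γ t`, while the squared norm exceeds the square of that coefficient by `β²`.
  refine (hγ.windingPotential_eq_of_segment x _ fun l hl u => ?_).symm
  have e2 : x + l • (β / ε - α) • γ t = (α + l * (β / ε - α)) • γ t + β • normal γ t := by
    conv_lhs => rw [hdec]
    rw [smul_smul, add_smul]
    abel
  have hn2 := hγ.norm_collar_sq t (α + l * (β / ε - α)) β
  rw [← e2] at hn2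
  have hl2 : 0 ≤ l * (β / ε - α) := mul_nonneg hl.1 (sub_nonneg.2 hle)
  have h5 : inner ℝ (x + l • (β / ε - α) • γ t) (γ u) ≤ α + l * (β / ε - α) := by
    rw [inner_add_left, smul_smul, inner_smul_left, RCLike.conj_to_real]
    have h6 : inner ℝ (γ t) (γ u) ≤ 1 := by
      simpa [hγ.norm_eq] using real_inner_le_norm (γ t) (γ u)
    nlinarith [ht u]
  have h7 : 0 < β ^ 2 := by positivity
  refine h5.trans_lt (lt_of_pow_lt_pow_left₀ 2 (norm_nonneg _) ?_)
  linarith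

end IsSimpleClosedArcLengthCurve

/-! ### The jump of the winding potential across the curve -/

theorem integral_poisson_le {e δ : ℝ} (he : 0 < e) :
    ∫ t in (-δ)..δ, e / (t ^ 2 + e ^ 2) ≤ Real.pi := by
  have hd : ∀ t, HasDerivAt (fun t => Real.arctan (t / e)) (e / (t ^ 2 + e ^ 2)) t := fun t => by
    refine ((hasDerivAt_id t).div_const e).arctan.congr_deriv ?_
    have : t ^ 2 + e ^ 2 ≠ 0 := by positivity
    have : 1 + (t / e) ^ 2 ≠ 0 := by positivity
    simp only [id]
    field_simp
    ring
  have hc : Continuous fun t : ℝ => e / (t ^ 2 + e ^ 2) :=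
    Continuous.div (by fun_prop) (by fun_prop) fun t => by positivity
  rw [intervalIntegral.integral_eq_sub_of_hasDerivAt (fun t _ => hd t)
    (hc.intervalIntegrable _ _)]
  linarith [Real.arctan_lt_pi_div_two (δ / e), Real.neg_pi_div_two_lt_arctan (-δ / e)]

theorem le_of_perturbed_sq_le {ρ ε d p q D : ℝ} (hρ0 : 0 ≤ ρ) (hn : ρ ^ 2 = 1 + ε ^ 2)
    (hε2 : ε ^ 2 ≤ 1) (hp : |p| ≤ |d| / 10) (hq : |q| ≤ |d| / 10)
    (h : (ρ * (d + p)) ^ 2 + (ε - ρ * q) ^ 2 ≤ 2 * ρ * D) (hD : 0 ≤ D) :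
    (d ^ 2 + ε ^ 2) / 8 ≤ D := by
  have hρ2 : ρ ≤ 2 := by nlinarith
  have hq2 : q ^ 2 ≤ d ^ 2 / 100 := by
    have : |q| ^ 2 ≤ (|d| / 10) ^ 2 := by gcongr
    rw [div_pow, sq_abs, sq_abs] at this
    linarith
  have hp2 : 81 / 100 * d ^ 2 ≤ (d + p) ^ 2 := by
    have h1 : 9 / 10 * |d| ≤ |d + p| := by
      have := abs_sub_abs_le_abs_sub d (-p)
      rw [abs_neg, sub_neg_eq_add] at this
      linarith
    have : (9 / 10 * |d|) ^ 2 ≤ |d + p| ^ 2 := by gcongr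
    rw [mul_pow, sq_abs, sq_abs] at this
    linarith
  have hρs : 1 ≤ ρ ^ 2 := by linarith [sq_nonneg ε]
  have h1 : ε ^ 2 / 2 - ρ ^ 2 * q ^ 2 ≤ (ε - ρ * q) ^ 2 := by
    nlinarith [sq_nonneg (ε - 2 * (ρ * q))]
  have h2 : ρ ^ 2 * q ^ 2 ≤ ρ ^ 2 * (d ^ 2 / 100) := by gcongr
  have h3 : ρ ^ 2 * (81 / 100 * d ^ 2) ≤ (ρ * (d + p)) ^ 2 := by
    rw [mul_pow]; gcongr
  have h4 : d ^ 2 ≤ ρ ^ 2 * d ^ 2 := le_mul_of_one_le_left (sq_nonneg d) hρs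
  have h5 : 2 * ρ * D ≤ 2 * 2 * D := by gcongr
  linarith [sq_nonneg d]

namespace IsSimpleClosedArcLengthCurve

variable {γ : ℝ → E3} {L : ℝ}

theorem abs_inner_normal_le (hγ : IsSimpleClosedArcLengthCurve γ L) {M : ℝ} (hM1 : 1 ≤ M)
    (hM : ∀ t u, ‖deriv γ u - deriv γ t‖ ≤ M * |u - t|) (t u : ℝ) :
    |inner ℝ (γ t) (normal γ u)| ≤ M * (u - t) ^ 2 := by
  have h1 := abs_real_inner_le_norm (γ t - γ u - (t - u) • deriv γ u) (normal γ u)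
  rw [inner_sub_left, inner_sub_left, inner_smul_left, inner_normal, inner_deriv_normal,
    hγ.norm_normal] at h1
  have h2 := hγ.taylor hM1 hM u t
  simp only [sub_zero, mul_zero, mul_one] at h1
  calc _ ≤ _ := h1
    _ ≤ M * (t - u) ^ 2 := h2
    _ = M * (u - t) ^ 2 := by ring

/-- With `x` the collar point and `ρ = ‖x‖`, one has `2ρ(ρ - x·γ(u)) = ‖x - ρ γ(u)‖²`. The
tangential and normal coordinates of `x - ρ γ(u)` are `-ρ(u - t)` and `ε` up to Taylor errors of
size `ρ|u - t|/10`. -/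
theorem le_norm_sub_inner (hγ : IsSimpleClosedArcLengthCurve γ L) {M : ℝ} (hM1 : 1 ≤ M)
    (hM : ∀ t u, ‖deriv γ u - deriv γ t‖ ≤ M * |u - t|) {t u ε : ℝ} (hε : |ε| ≤ 1)
    (hu : M * |u - t| ≤ 1 / 10) :
    ((u - t) ^ 2 + ε ^ 2) / 8 ≤
      ‖γ t + ε • normal γ t‖ - inner ℝ (γ t + ε • normal γ t) (γ u) := by
  have hn := hγ.norm_collar_sq t 1 ε
  rw [one_smul] at hn
  obtain ⟨f, hf0, hf1, hf2⟩ := hγ.exists_frame t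
  have hxd : inner ℝ (deriv γ t) (γ t + ε • normal γ t) = 0 := by
    rw [inner_add_right, inner_smul_right, inner_deriv_normal, real_inner_comm, hγ.inner_deriv]
    simp
  have hxn : inner ℝ (normal γ t) (γ t + ε • normal γ t) = ε := by
    rw [inner_add_right, inner_smul_right, real_inner_self_eq_norm_sq, hγ.norm_normal,
      real_inner_comm, inner_normal]
    simp
  set x := γ t + ε • normal γ t
  set ρ := ‖x‖
  set d := u - t
  have hρ0 : 0 ≤ ρ := norm_nonneg x
  have hε2 : ε ^ 2 ≤ 1 := by rw [← sq_abs]; exact pow_le_one₀ (abs_nonneg _) hε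
  have hT := hγ.taylor hM1 hM t u
  set r := γ u - γ t - d • deriv γ t with hr
  have hu' : γ u = γ t + d • deriv γ t + r := by rw [hr]; abel
  have hrd : ‖r‖ ≤ |d| / 10 := by
    calc _ ≤ _ := hT
      _ = M * |d| * |d| := by rw [mul_assoc, abs_mul_abs_self, sq]
      _ ≤ 1 / 10 * |d| := by gcongr
      _ = |d| / 10 := by ring
  have e1 : inner ℝ (deriv γ t) (γ u) = d + inner ℝ (deriv γ t) r := by
    rw [hu', inner_add_right, inner_add_right, inner_smul_right, real_inner_self_eq_norm_sq,
      hγ.unit_speed, real_inner_comm, hγ.inner_deriv]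
    ring
  have e2 : inner ℝ (normal γ t) (γ u) = inner ℝ (normal γ t) r := by
    rw [hu', inner_add_right, inner_add_right, inner_smul_right, real_inner_comm, inner_normal,
      real_inner_comm (deriv γ t), inner_deriv_normal]
    ring
  have b1 : |inner ℝ (deriv γ t) r| ≤ |d| / 10 := by
    refine (abs_real_inner_le_norm _ _).trans ?_
    rwa [hγ.unit_speed, one_mul]
  have b2 : |inner ℝ (normal γ t) r| ≤ |d| / 10 := by
    refine (abs_real_inner_le_norm _ _).trans ?_
    rwa [hγ.norm_normal, one_mul]
  set p := inner ℝ (deriv γ t) r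
  set q := inner ℝ (normal γ t) r
  have hz : ‖x - ρ • γ u‖ ^ 2 = 2 * ρ * (ρ - inner ℝ x (γ u)) := by
    rw [norm_sub_sq_real, norm_smul, inner_smul_right, hγ.norm_eq, Real.norm_of_nonneg hρ0]
    ring
  have hz2 : (ρ * (d + p)) ^ 2 + (ε - ρ * q) ^ 2 ≤ ‖x - ρ • γ u‖ ^ 2 := by
    rw [← f.sum_sq_norm_inner_right (x - ρ • γ u), Fin.sum_univ_three, hf0, hf1, hf2]
    simp only [Real.norm_eq_abs, sq_abs]
    rw [inner_sub_right (deriv γ t), inner_sub_right (normal γ t), hxd, hxn, inner_smul_right,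
      inner_smul_right, e1, e2]
    nlinarith [sq_nonneg (inner ℝ (γ t) (x - ρ • γ u))]
  have hpos : 0 ≤ ρ - inner ℝ x (γ u) := by
    have := real_inner_le_norm x (γ u)
    rw [hγ.norm_eq, mul_one] at this
    linarith
  rw [hz] at hz2
  rw [one_pow] at hn
  exact le_of_perturbed_sq_le hρ0 hn hε2 b1 b2 hz2 hpos

/-- The numerator is at most `M(u - t)² + |ε|`: its first part is absorbed by the denominator, its
second gives a Poisson kernel, whose mass is at most `π` for every `ε`. -/
theorem abs_windingDensity_le (hγ : IsSimpleClosedArcLengthCurve γ L) {M : ℝ} (hM1 : 1 ≤ M)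
    (hM : ∀ t u, ‖deriv γ u - deriv γ t‖ ≤ M * |u - t|) {t u ε : ℝ} (hε : |ε| ≤ 1) (hε0 : ε ≠ 0)
    (hu : M * |u - t| ≤ 1 / 10) :
    |windingDensity γ (γ t + ε • normal γ t) u| ≤
      8 * M + 8 * (|ε| / ((u - t) ^ 2 + |ε| ^ 2)) := by
  have hD := hγ.le_norm_sub_inner hM1 hM hε hu
  have hN : |inner ℝ (γ t + ε • normal γ t) (normal γ u)| ≤ M * (u - t) ^ 2 + |ε| := by
    rw [inner_add_left, inner_smul_left]
    refine (abs_add_le _ _).trans (add_le_add (hγ.abs_inner_normal_le hM1 hM t u) ?_)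
    rw [abs_mul]
    have := abs_real_inner_le_norm (normal γ t) (normal γ u)
    rw [hγ.norm_normal, hγ.norm_normal, one_mul] at this
    exact mul_le_of_le_one_right (abs_nonneg _) this
  have hq : 0 < ((u - t) ^ 2 + ε ^ 2) / 8 := by positivity
  rw [windingDensity, abs_div, abs_of_pos (hq.trans_le hD)]
  calc _ ≤ (M * (u - t) ^ 2 + |ε|) / (((u - t) ^ 2 + ε ^ 2) / 8) := by gcongr
    _ ≤ 8 * M + 8 * (|ε| / ((u - t) ^ 2 + |ε| ^ 2)) := by
      rw [sq_abs, div_le_iff₀ hq]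
      have : |ε| / ((u - t) ^ 2 + ε ^ 2) * ((u - t) ^ 2 + ε ^ 2) = |ε| :=
        div_mul_cancel₀ _ (by positivity)
      nlinarith [mul_nonneg (zero_le_one.trans hM1) (sq_nonneg ε)]

theorem abs_integral_windingDensity_le (hγ : IsSimpleClosedArcLengthCurve γ L) {M : ℝ}
    (hM1 : 1 ≤ M) (hM : ∀ t u, ‖deriv γ u - deriv γ t‖ ≤ M * |u - t|) {δ ε : ℝ} (hδ : 0 ≤ δ)
    (hδM : M * δ ≤ 1 / 10) (hε : |ε| ≤ 1) (hε0 : ε ≠ 0) :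
    |∫ t in (-δ)..δ, windingDensity γ (γ 0 + ε • normal γ 0) t| ≤ 2 + 8 * Real.pi := by
  have hM0 : 0 ≤ M := by linarith
  have hc : Continuous fun t : ℝ => |ε| / (t ^ 2 + |ε| ^ 2) :=
    Continuous.div (by fun_prop) (by fun_prop) fun t => by positivity
  have hle : -δ ≤ δ := by linarith
  have h1 : |∫ t in (-δ)..δ, windingDensity γ (γ 0 + ε • normal γ 0) t|
      ≤ ∫ t in (-δ)..δ, (8 * M + 8 * (|ε| / (t ^ 2 + |ε| ^ 2))) := by
    have hc' : Continuous fun t : ℝ => 8 * M + 8 * (|ε| / (t ^ 2 + |ε| ^ 2)) := by fun_prop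
    rw [← Real.norm_eq_abs]
    refine intervalIntegral.norm_integral_le_of_norm_le hle
      (Eventually.of_forall fun t ht => ?_) (hc'.intervalIntegrable (μ := volume) _ _)
    have hu : M * |t - 0| ≤ 1 / 10 := by
      refine le_trans ?_ hδM
      rw [sub_zero]
      have : |t| ≤ δ := abs_le.2 ⟨ht.1.le, ht.2⟩
      gcongr
    have := hγ.abs_windingDensity_le hM1 hM hε hε0 hu
    rwa [sub_zero] at this
  have i1 : IntervalIntegrable (fun _ : ℝ => 8 * M) volume (-δ) δ := intervalIntegrable_const
  have i2 : IntervalIntegrable (fun t : ℝ => 8 * (|ε| / (t ^ 2 + |ε| ^ 2))) volume (-δ) δ :=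
    (hc.const_mul 8).intervalIntegrable _ _
  rw [intervalIntegral.integral_add i1 i2,
    intervalIntegral.integral_const, intervalIntegral.integral_const_mul] at h1
  have h2 := integral_poisson_le (δ := δ) (abs_pos.2 hε0)
  rw [smul_eq_mul] at h1
  nlinarith

/-- The parts of the winding potential away from a point of the curve match on the two sides. -/
theorem eventually_far_part (hγ : IsSimpleClosedArcLengthCurve γ L) {δ : ℝ} (hδ : 0 < δ)
    (hδL : δ ≤ L - δ) :
    ∀ᶠ ε in 𝓝 (0 : ℝ), |(∫ t in δ..(L - δ), windingDensity γ (γ 0 + ε • normal γ 0) t)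
      - ∫ t in δ..(L - δ), windingDensity γ (γ 0 + (-ε) • normal γ 0) t| < 1 := by
  obtain ⟨m, hm, hsep⟩ := hγ.exists_separation hδ
  have hγc := hγ.continuous
  have hνc := hγ.continuous_normal
  -- Truncating the denominator makes the integrand jointly continuous; for small `ε` the truncation
  -- is inactive, because `1 - γ(0)·γ(t) ≥ m²/2` on the far range.
  let g : ℝ → ℝ → ℝ := fun ε t => inner ℝ (γ 0 + ε • normal γ 0) (normal γ t) /
    max (‖γ 0 + ε • normal γ 0‖ - inner ℝ (γ 0 + ε • normal γ 0) (γ t)) (m ^ 2 / 4)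
  have hg : Continuous (Function.uncurry g) :=
    Continuous.div (by fun_prop) (by fun_prop) fun p =>
      (lt_of_lt_of_le (by positivity) (le_max_right _ _)).ne'
  have hG : Continuous fun ε => ∫ t in δ..(L - δ), g ε t :=
    intervalIntegral.continuous_parametric_intervalIntegral_of_continuous' hg _ _
  have heq : ∀ ε, |ε| ≤ m ^ 2 / 4 → ∀ t ∈ uIcc δ (L - δ),
      windingDensity γ (γ 0 + ε • normal γ 0) t = g ε t := by
    intro ε hε t ht
    rw [uIcc_of_le hδL] at ht
    have h1 := hsep 0 t ht
    rw [zero_add] at h1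
    have h2 : ‖γ t - γ 0‖ ^ 2 = 2 - 2 * inner ℝ (γ 0) (γ t) := by
      rw [norm_sub_sq_real, hγ.norm_eq, hγ.norm_eq, real_inner_comm]; ring
    have h3 : m ^ 2 ≤ ‖γ t - γ 0‖ ^ 2 := by gcongr
    have hn := hγ.norm_collar_sq 0 1 ε
    rw [one_smul] at hn
    have hρ1 : 1 ≤ ‖γ 0 + ε • normal γ 0‖ := by
      nlinarith [norm_nonneg (γ 0 + ε • normal γ 0), sq_nonneg ε]
    have h4 : |ε * inner ℝ (normal γ 0) (γ t)| ≤ |ε| := by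
      rw [abs_mul]
      have := abs_real_inner_le_norm (normal γ 0) (γ t)
      rw [hγ.norm_normal, hγ.norm_eq, one_mul] at this
      exact mul_le_of_le_one_right (abs_nonneg _) this
    have h5 : inner ℝ (γ 0 + ε • normal γ 0) (γ t)
        = inner ℝ (γ 0) (γ t) + ε * inner ℝ (normal γ 0) (γ t) := by
      rw [inner_add_left, inner_smul_left, RCLike.conj_to_real]
    simp only [windingDensity, g]
    rw [max_eq_left]
    linarith [le_abs_self (ε * inner ℝ (normal γ 0) (γ t))]
  have hlim : ∀ᶠ ε in 𝓝 (0 : ℝ),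
      |(∫ t in δ..(L - δ), g ε t) - ∫ t in δ..(L - δ), g (-ε) t| < 1 := by
    have hc : Continuous fun ε =>
        |(∫ t in δ..(L - δ), g ε t) - ∫ t in δ..(L - δ), g (-ε) t| :=
      (hG.sub (hG.comp continuous_neg)).abs
    exact hc.continuousAt.eventually_lt continuousAt_const (by simp)
  have hsmall : ∀ᶠ ε in 𝓝 (0 : ℝ), |ε| ≤ m ^ 2 / 4 :=
    (continuous_abs.continuousAt.eventually_lt continuousAt_const
      (by rw [abs_zero]; positivity)).mono fun _ h => h.le
  filter_upwards [hlim, hsmall] with ε h1 h2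
  rwa [intervalIntegral.integral_congr (heq ε h2),
    intervalIntegral.integral_congr (heq (-ε) (by rwa [abs_neg]))]

theorem windingPotential_eq_add (hγ : IsSimpleClosedArcLengthCurve γ L) {x : E3}
    (hx : OffCone γ x) (δ : ℝ) :
    windingPotential γ L x =
      (∫ t in (-δ)..δ, windingDensity γ x t) + ∫ t in δ..(L - δ), windingDensity γ x t := by
  have hc := hγ.continuous_windingDensity hx
  have hp : Function.Periodic (windingDensity γ x) L := fun t => by
    simp only [windingDensity, hγ.periodic t, hγ.periodic_normal t]
  have := hp.intervalIntegral_add_eq 0 (-δ)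
  rw [zero_add, neg_add_eq_sub] at this
  rw [windingPotential, this, intervalIntegral.integral_add_adjacent_intervals
    (hc.intervalIntegrable _ _) (hc.intervalIntegrable _ _)]

theorem exists_jump_le (hγ : IsSimpleClosedArcLengthCurve γ L) {ε₀ : ℝ} (hε₀ : 0 < ε₀)
    (hcol : ∀ ε, ε ≠ 0 → |ε| < ε₀ → ∀ t, OffCone γ (γ t + ε • normal γ t)) :
    ∃ ε, 0 < ε ∧ ε < ε₀ ∧ |windingPotential γ L (γ 0 + ε • normal γ 0)
      - windingPotential γ L (γ 0 + (-ε) • normal γ 0)| ≤ 5 + 16 * Real.pi := by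
  obtain ⟨M, hM1, hM⟩ := hγ.exists_lipschitz
  have hM0 : 0 < M := by linarith
  have hL := hγ.pos
  set δ := min (1 / (10 * M)) (L / 4)
  have hδ : 0 < δ := by positivity
  have hδM : M * δ ≤ 1 / 10 := by
    calc M * δ ≤ M * (1 / (10 * M)) := by gcongr; exact min_le_left _ _
      _ = 1 / 10 := by field_simp
  have hδL : δ ≤ L - δ := by linarith [min_le_right (1 / (10 * M)) (L / 4)]
  have hev : ∀ᶠ ε in 𝓝[>] (0 : ℝ), 0 < ε ∧ ε < min 1 ε₀ :=
    Ioo_mem_nhdsGT (lt_min one_pos hε₀)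
  obtain ⟨ε, ⟨h0, h1⟩, h2⟩ :=
    (hev.and ((hγ.eventually_far_part hδ hδL).filter_mono nhdsWithin_le_nhds)).exists
  have hε₁ := lt_of_lt_of_le h1 (min_le_left _ _)
  have hε₂ := lt_of_lt_of_le h1 (min_le_right _ _)
  refine ⟨ε, h0, hε₂, ?_⟩
  have o1 := hcol ε h0.ne' (by rwa [abs_of_pos h0]) 0
  have o2 := hcol (-ε) (by linarith) (by rwa [abs_neg, abs_of_pos h0]) 0
  rw [hγ.windingPotential_eq_add o1 δ, hγ.windingPotential_eq_add o2 δ]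
  have n1 := hγ.abs_integral_windingDensity_le hM1 hM hδ.le hδM (ε := ε)
    (by rw [abs_of_pos h0]; exact hε₁.le) h0.ne'
  have n2 := hγ.abs_integral_windingDensity_le hM1 hM hδ.le hδM (ε := -ε)
    (by rw [abs_neg, abs_of_pos h0]; exact hε₁.le) (by linarith)
  rw [abs_le] at n1 n2 ⊢
  rw [abs_lt] at h2
  -- Each near part contributes `2 + 8π` and the far parts differ by less than `1`.
  constructor <;> linarith [n1.1, n1.2, n2.1, n2.2, h2.1, h2.2]

/-- The winding potential of a simple closed spherical curve has universally bounded oscillation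
off the cone over the curve. -/
theorem exists_abs_windingPotential_sub_le (hγ : IsSimpleClosedArcLengthCurve γ L) :
    ∃ a : ℝ, ∀ x, OffCone γ x → |windingPotential γ L x - a| ≤ 5 + 16 * Real.pi := by
  obtain ⟨ε₀, hε₀, hcol⟩ := hγ.exists_collar
  obtain ⟨ε, h0, h1, hj⟩ := hγ.exists_jump_le hε₀ hcol
  have hae : |ε| < ε₀ := by rwa [abs_of_pos h0]
  refine ⟨windingPotential γ L (γ 0 + ε • normal γ 0), fun x hx => ?_⟩
  obtain ⟨t, β, η, hβ, hη, h⟩ := hγ.exists_windingPotential_eq hx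
  have hm : 0 < min η ε₀ / 2 := by positivity
  have hm1 : min η ε₀ / 2 < η := by linarith [min_le_left η ε₀, lt_min hη hε₀]
  have hm2 : min η ε₀ / 2 < ε₀ := by linarith [min_le_right η ε₀, lt_min hη hε₀]
  set κ := min η ε₀ / 2
  rcases lt_or_gt_of_ne hβ with hb | hb
  · rw [h (-κ) (by nlinarith) (by rwa [abs_neg, abs_of_pos hm]),
      hγ.windingPotential_collar hcol (ε := -κ) (η := -ε) (by rwa [abs_neg, abs_of_pos hm])
        (by rwa [abs_neg]) (by nlinarith) t 0, abs_sub_comm]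
    exact hj
  · rw [h κ (by positivity) (by rwa [abs_of_pos hm]),
      hγ.windingPotential_collar hcol (ε := κ) (η := ε) (by rwa [abs_of_pos hm])
        hae (by positivity) t 0, sub_self, abs_zero]
    positivity

end IsSimpleClosedArcLengthCurve

/-! ### First moments of the winding density over the unit ball -/

/-- The winding density of the great circle through the first two coordinate axes, at the first
coordinate vector. -/
def poleDensity (y : E3) : ℝ := y 2 / (‖y‖ - y 0)

/-- The first moment of `poleDensity` over the unit ball. -/
def poleMoment : ℝ := ∫ y in Metric.ball (0 : E3) 1, y 2 * poleDensity y

theorem integrableOn_inv_sqrt_abs :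
    IntegrableOn (fun x : ℝ => (√|x|)⁻¹) (Ioo (-1) 1) volume := by
  have h1 : IntegrableOn (fun x : ℝ => (√|x|)⁻¹) (Ioc 0 1) volume := by
    have := intervalIntegral.intervalIntegrable_rpow' (a := 0) (b := 1) (r := -(1 / 2))
      (by norm_num)
    rw [intervalIntegrable_iff_integrableOn_Ioc_of_le zero_le_one] at this
    refine this.congr_fun (fun x hx => ?_) measurableSet_Ioc
    simp only
    rw [abs_of_pos hx.1, Real.rpow_neg hx.1.le, Real.sqrt_eq_rpow]
  have h2 : IntegrableOn (fun x : ℝ => (√|x|)⁻¹) (Ico (-1) 0) volume := by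
    have h := (Measure.measurePreserving_neg (volume : Measure ℝ)).integrableOn_comp_preimage
      (Homeomorph.neg ℝ).measurableEmbedding (f := fun x : ℝ => (√|x|)⁻¹) (s := Ioc 0 1)
    simpa [Function.comp_def] using h.2 h1
  have h3 : IntegrableOn (fun x : ℝ => (√|x|)⁻¹) {0} volume := by simp
  refine ((h2.union h1).union h3).mono_set fun x hx => ?_
  rcases lt_trichotomy x 0 with h | h | h
  · exact Or.inl (Or.inl ⟨hx.1.le, h⟩)
  · exact Or.inr h
  · exact Or.inl (Or.inr ⟨h, hx.2.le⟩)

theorem norm_sq_eq_coord (y : E3) : ‖y‖ ^ 2 = y 0 ^ 2 + y 1 ^ 2 + y 2 ^ 2 := by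
  rw [← real_inner_self_eq_norm_sq, inner_eq]; ring

theorem abs_coord_le_norm (y : E3) (i : Fin 3) : |y i| ≤ ‖y‖ := by
  simpa using PiLp.norm_apply_le y i

theorem div_sq_add_sq_le {a b : ℝ} (ha : 0 < a) (hb : 0 ≤ b) :
    b / (a ^ 2 + b ^ 2) ≤ (√a)⁻¹ * (√b)⁻¹ := by
  rcases hb.eq_or_lt with rfl | hb
  · simp
  have e1 : √a ^ 2 = a := Real.sq_sqrt ha.le
  have e2 : √b ^ 2 = b := Real.sq_sqrt hb.le
  have p1 : 0 < √a := Real.sqrt_pos.2 ha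
  have p2 : 0 < √b := Real.sqrt_pos.2 hb
  rw [← mul_inv, ← one_div, div_le_div_iff₀ (by positivity) (by positivity)]
  have h : √a * √b ≤ (a + b) / 2 := by nlinarith [sq_nonneg (√a - √b)]
  nlinarith [sq_nonneg (a - b / 4), sq_nonneg b]

/-- Rationalising with `(‖y‖ - y₀)(‖y‖ + y₀) = y₁² + y₂²` shows that the singularity along the ray
is integrable. -/
theorem abs_poleDensity_le {y : E3} (hy : ‖y‖ < 1) (h1 : y 1 ≠ 0) :
    |poleDensity y| ≤ 2 * ((√|y 1|)⁻¹ * (√|y 2|)⁻¹) := by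
  have hn := norm_sq_eq_coord y
  have h1' : 0 < y 1 ^ 2 := by positivity
  have hlt : |y 0| < ‖y‖ := by
    apply lt_of_pow_lt_pow_left₀ 2 (norm_nonneg _)
    rw [sq_abs]
    nlinarith [sq_nonneg (y 2)]
  obtain ⟨hl, hr⟩ := abs_lt.1 hlt
  have hD : 0 < ‖y‖ - y 0 := by linarith
  have hS : 0 < ‖y‖ + y 0 := by linarith
  have key : |poleDensity y| = (‖y‖ + y 0) * (|y 2| / (|y 1| ^ 2 + |y 2| ^ 2)) := by
    rw [poleDensity, abs_div, abs_of_pos hD, sq_abs, sq_abs,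
      show y 1 ^ 2 + y 2 ^ 2 = (‖y‖ - y 0) * (‖y‖ + y 0) by linarith]
    field_simp
  rw [key]
  exact mul_le_mul (by linarith) (div_sq_add_sq_le (abs_pos.2 h1) (abs_nonneg _))
    (by positivity) (by norm_num)

theorem measurable_poleDensity : Measurable poleDensity := by
  unfold poleDensity
  exact Measurable.div (by fun_prop) (by fun_prop)

theorem integrableOn_poleDensity : IntegrableOn poleDensity (Metric.ball (0 : E3) 1) := by
  let f : Fin 3 → ℝ → ℝ := ![fun _ => 1, fun x => (√|x|)⁻¹, fun x => (√|x|)⁻¹]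
  have h1 : Integrable (fun x : Fin 3 → ℝ => ∏ i, f i (x i))
      (Measure.pi fun _ => volume.restrict (Ioo (-1) 1)) := by
    refine Integrable.fintype_prod fun i => ?_
    fin_cases i
    · exact integrable_const _
    · exact integrableOn_inv_sqrt_abs
    · exact integrableOn_inv_sqrt_abs
  rw [← Measure.restrict_pi_pi] at h1
  have h2 : IntegrableOn (fun y : E3 => ∏ i, f i (y i))
      (WithLp.ofLp ⁻¹' (univ.pi fun _ => Ioo (-1) 1)) volume :=
    ((PiLp.volume_preserving_ofLp (Fin 3)).integrableOn_comp_preimage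
      (MeasurableEquiv.toLp 2 (Fin 3 → ℝ)).symm.measurableEmbedding).2 h1
  have h3 : Metric.ball (0 : E3) 1 ⊆ WithLp.ofLp ⁻¹' (univ.pi fun _ => Ioo (-1) 1) := by
    intro y hy i _
    rw [mem_ball_zero_iff] at hy
    exact abs_lt.1 ((abs_coord_le_norm y i).trans_lt hy)
  have hne : ∀ᵐ y : E3, y 1 ≠ 0 :=
    (PiLp.volume_preserving_ofLp (Fin 3)).quasiMeasurePreserving.ae
      (Measure.ae_eval_ne (fun _ : Fin 3 => (volume : Measure ℝ)) 1 0)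
  refine ((h2.mono_set h3).const_mul 2).mono' measurable_poleDensity.aestronglyMeasurable ?_
  filter_upwards [ae_restrict_of_ae hne, ae_restrict_mem measurableSet_ball] with y hy hb
  rw [mem_ball_zero_iff] at hb
  have := abs_poleDensity_le hb hy
  simpa [Fin.prod_univ_three, f] using this

theorem poleMoment_pos : 0 < poleMoment := by
  have hnn : ∀ y : E3, 0 ≤ y 2 * poleDensity y := fun y => by
    have := (le_abs_self _).trans (abs_coord_le_norm y 0)
    rw [poleDensity, ← mul_div_assoc]
    exact div_nonneg (mul_self_nonneg _) (by linarith)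
  have hi : IntegrableOn (fun y : E3 => y 2 * poleDensity y) (Metric.ball (0 : E3) 1) := by
    refine integrableOn_poleDensity.norm.mono'
      (Measurable.mul (by fun_prop) measurable_poleDensity).aestronglyMeasurable ?_
    filter_upwards [ae_restrict_mem measurableSet_ball] with y hb
    rw [mem_ball_zero_iff] at hb
    rw [norm_mul]
    refine mul_le_of_le_one_left (norm_nonneg _) ?_
    exact (abs_coord_le_norm y 2).trans hb.le
  rw [poleMoment, setIntegral_pos_iff_support_of_nonneg_ae (Eventually.of_forall hnn) hi]
  let c : E3 := EuclideanSpace.single 2 (1 / 2)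
  refine (Metric.measure_ball_pos volume c (r := 1 / 4) (by norm_num)).trans_le
    (measure_mono fun y hy => ?_)
  rw [mem_ball_iff_norm] at hy
  have h2 := (abs_coord_le_norm (y - c) 2).trans_lt hy
  have hc : ‖c‖ = 1 / 2 := by simp [c]
  have hc2 : (y - c) 2 = y 2 - 1 / 2 := by simp [c]
  rw [hc2] at h2
  have hy2 : 0 < y 2 := by linarith [(abs_lt.1 h2).1]
  have hyn : ‖y‖ < 1 := by
    have := norm_add_le (y - c) c
    rw [sub_add_cancel] at this
    linarith
  have h0 : y 0 < ‖y‖ := by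
    apply lt_of_pow_lt_pow_left₀ 2 (norm_nonneg _)
    rw [norm_sq_eq_coord]
    nlinarith [sq_nonneg (y 1)]
  refine ⟨?_, by rwa [mem_ball_zero_iff]⟩
  rw [Function.mem_support, poleDensity]
  have : 0 < ‖y‖ - y 0 := by linarith
  positivity

/-! ### Change of frame -/

theorem preimage_ball_of_isometry (f : E3 ≃ₗᵢ[ℝ] E3) :
    f ⁻¹' Metric.ball (0 : E3) 1 = Metric.ball (0 : E3) 1 := by
  ext x
  simp

theorem setIntegral_ball_comp (f : E3 ≃ₗᵢ[ℝ] E3) (g : E3 → ℝ) :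
    ∫ x in Metric.ball (0 : E3) 1, g (f x) = ∫ x in Metric.ball (0 : E3) 1, g x := by
  have := f.measurePreserving.setIntegral_preimage_emb f.toHomeomorph.measurableEmbedding g
    (Metric.ball (0 : E3) 1)
  rwa [preimage_ball_of_isometry] at this

theorem integrableOn_ball_comp (f : E3 ≃ₗᵢ[ℝ] E3) {g : E3 → ℝ}
    (hg : IntegrableOn g (Metric.ball (0 : E3) 1)) :
    IntegrableOn (fun x => g (f x)) (Metric.ball (0 : E3) 1) := by
  have := (f.measurePreserving.integrableOn_comp_preimage f.toHomeomorph.measurableEmbedding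
    (s := Metric.ball (0 : E3) 1)).2 hg
  rwa [preimage_ball_of_isometry] at this

theorem integrableOn_inner_mul {w : E3 → ℝ} (hw : IntegrableOn w (Metric.ball (0 : E3) 1))
    (e : E3) : IntegrableOn (fun x => inner ℝ x e * w x) (Metric.ball (0 : E3) 1) := by
  refine (hw.norm.const_mul ‖e‖).mono'
    (AEStronglyMeasurable.mul (Continuous.aestronglyMeasurable (by fun_prop)) hw.1) ?_
  filter_upwards [ae_restrict_mem measurableSet_ball] with x hb
  rw [mem_ball_zero_iff] at hb
  rw [norm_mul]
  gcongr
  refine (norm_inner_le_norm x e).trans ?_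
  exact mul_le_of_le_one_left (norm_nonneg _) hb.le

theorem poleDensity_repr (b : OrthonormalBasis (Fin 3) ℝ E3) (x : E3) :
    poleDensity (b.repr x) = inner ℝ x (b 2) / (‖x‖ - inner ℝ x (b 0)) := by
  rw [poleDensity, b.repr.norm_map, b.repr_apply_apply, b.repr_apply_apply,
    real_inner_comm, real_inner_comm (b 0)]

/-- The first moments of the pole density in a rotated frame. -/
theorem setIntegral_inner_mul_poleDensity (b : OrthonormalBasis (Fin 3) ℝ E3) (e : E3) :
    ∫ x in Metric.ball (0 : E3) 1, inner ℝ x e * poleDensity (b.repr x)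
      = poleMoment * inner ℝ e (b 2) := by
  have hw := integrableOn_ball_comp b.repr integrableOn_poleDensity
  have hb2 : ‖b 2‖ = 1 := b.norm_eq_one 2
  -- Reflection in the plane orthogonal to `b 2` changes the sign of the density, so only the
  -- component of `e` along `b 2` contributes.
  let σ : E3 ≃ₗᵢ[ℝ] E3 := (ℝ ∙ b 2)ᗮ.reflection
  have hσ : ∀ x, σ x = x - (2 * inner ℝ x (b 2)) • b 2 := fun x => by
    simp only [σ, Submodule.reflection_orthogonal_apply, Submodule.reflection_singleton_apply,
      hb2, real_inner_comm x (b 2)]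
    simp [two_smul, mul_smul]
  have h02 : inner ℝ (b 2) (b 0) = 0 := b.inner_eq_zero (by decide)
  have hσw : ∀ x, poleDensity (b.repr (σ x)) = - poleDensity (b.repr x) := fun x => by
    rw [poleDensity_repr, poleDensity_repr, σ.norm_map, hσ, inner_sub_left, inner_sub_left,
      inner_smul_left, inner_smul_left, h02, real_inner_self_eq_norm_sq, hb2, ← neg_div]
    congr 1
    · simp; ring
    · simp
  have h1 := setIntegral_ball_comp σ fun x => inner ℝ x e * poleDensity (b.repr x)
  have h2 : ∀ x, inner ℝ (σ x) e * poleDensity (b.repr (σ x))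
      = (2 * inner ℝ e (b 2)) * (inner ℝ x (b 2) * poleDensity (b.repr x))
        - inner ℝ x e * poleDensity (b.repr x) := fun x => by
    rw [hσw, hσ, inner_sub_left, inner_smul_left, RCLike.conj_to_real, real_inner_comm e (b 2)]
    ring
  simp only [h2] at h1
  rw [integral_sub ((integrableOn_inner_mul hw (b 2)).const_mul _) (integrableOn_inner_mul hw e),
    integral_const_mul] at h1
  have h3 : ∫ x in Metric.ball (0 : E3) 1, inner ℝ x (b 2) * poleDensity (b.repr x)
      = poleMoment := by
    rw [poleMoment, ← setIntegral_ball_comp b.repr fun y => y 2 * poleDensity y]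
    simp only [b.repr_apply_apply, real_inner_comm]
  rw [h3] at h1
  linarith

theorem setIntegral_inner_eq_zero (e : E3) :
    ∫ x in Metric.ball (0 : E3) 1, inner ℝ x e = 0 := by
  have := setIntegral_ball_comp (LinearIsometryEquiv.neg ℝ) fun x => inner ℝ x e
  simp only [LinearIsometryEquiv.coe_neg, inner_neg_left] at this
  rw [integral_neg] at this
  linarith

/-! ### The vector area of a simple closed spherical curve -/

namespace IsSimpleClosedArcLengthCurve

variable {γ : ℝ → E3} {L : ℝ}

/-- The cone is contained in a `C¹` image of the plane, so its dimension is at most two. -/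
theorem ae_offCone (hγ : IsSimpleClosedArcLengthCurve γ L) : ∀ᵐ x : E3, OffCone γ x := by
  have hcd : ContDiff ℝ 1 fun p : ℝ × ℝ => p.1 • γ p.2 :=
    contDiff_fst.smul ((hγ.contDiff.of_le (by norm_num)).comp contDiff_snd)
  have hdim := hcd.dimH_range_le
  have hac : (volume : Measure E3) ≪ μH[((3 : NNReal) : ℝ)] := by
    have : (μH[((3 : NNReal) : ℝ)] : Measure E3).IsAddHaarMeasure := by
      simpa using isAddHaarMeasure_hausdorffMeasure (E := E3)
    exact Measure.absolutelyContinuous_isAddHaarMeasure _ _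
  have hz : volume (range fun p : ℝ × ℝ => p.1 • γ p.2) = 0 :=
    measure_zero_of_dimH_lt hac (hdim.trans_lt (by simp; norm_num))
  refine measure_mono_null (fun x hx => ?_) hz
  simp only [mem_compl_iff, mem_ofPred_eq, OffCone, not_forall, not_lt] at hx
  obtain ⟨t, ht⟩ := hx
  exact ⟨(‖x‖, t), (hγ.eq_smul_of_norm_le_inner ht).symm⟩

theorem windingDensity_eq_poleDensity (hγ : IsSimpleClosedArcLengthCurve γ L) (t : ℝ) :
    ∃ b : OrthonormalBasis (Fin 3) ℝ E3, b 2 = normal γ t ∧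
      ∀ x, windingDensity γ x t = poleDensity (b.repr x) := by
  obtain ⟨b, hb0, -, hb2⟩ := hγ.exists_frame t
  exact ⟨b, hb2, fun x => by rw [poleDensity_repr, hb0, hb2, windingDensity]⟩

theorem integrable_inner_mul_windingDensity (hγ : IsSimpleClosedArcLengthCurve γ L) (e : E3) :
    Integrable (Function.uncurry fun (x : E3) (t : ℝ) => inner ℝ x e * windingDensity γ x t)
      ((volume.restrict (Metric.ball (0 : E3) 1)).prod (volume.restrict (Ioc 0 L))) := by
  have hγc := hγ.continuous
  have hνc := hγ.continuous_normal
  have hm : Measurable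
      (Function.uncurry fun (x : E3) (t : ℝ) => inner ℝ x e * windingDensity γ x t) := by
    refine Measurable.mul (Continuous.measurable (by fun_prop)) (Measurable.div
      (Continuous.measurable (by fun_prop)) (Continuous.measurable (by fun_prop)))
  have hsm := hm.aestronglyMeasurable
    (μ := (volume.restrict (Metric.ball (0 : E3) 1)).prod (volume.restrict (Ioc 0 L)))
  have hint : ∀ t, Integrable (fun x => windingDensity γ x t)
      (volume.restrict (Metric.ball (0 : E3) 1)) := fun t => by
    obtain ⟨b, -, hb⟩ := hγ.windingDensity_eq_poleDensity t
    simp only [hb]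
    exact integrableOn_ball_comp b.repr integrableOn_poleDensity
  rw [integrable_prod_iff' hsm]
  refine ⟨Eventually.of_forall fun t => integrableOn_inner_mul (hint t) e, ?_⟩
  -- By rotation invariance the `L¹` norm of the density over the ball does not depend on `t`.
  refine (integrable_const (‖e‖ * ∫ y in Metric.ball (0 : E3) 1, |poleDensity y|)).mono'
    hsm.norm.prod_swap.integral_prod_right' (Eventually.of_forall fun t => ?_)
  rw [Real.norm_of_nonneg (integral_nonneg fun x => norm_nonneg _)]
  have h1 : ∫ x in Metric.ball (0 : E3) 1, |windingDensity γ x t|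
      = ∫ y in Metric.ball (0 : E3) 1, |poleDensity y| := by
    obtain ⟨b, -, hb⟩ := hγ.windingDensity_eq_poleDensity t
    simp only [hb]
    exact setIntegral_ball_comp b.repr fun y => |poleDensity y|
  rw [← h1, ← integral_const_mul]
  refine integral_mono_ae (integrableOn_inner_mul (hint t) e).norm
    ((hint t).norm.const_mul ‖e‖) ?_
  filter_upwards [ae_restrict_mem measurableSet_ball] with x hb
  rw [mem_ball_zero_iff] at hb
  simp only [Function.uncurry_apply_pair, norm_mul, Real.norm_eq_abs (windingDensity γ x t)]
  gcongr
  refine (norm_inner_le_norm x e).trans ?_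
  exact mul_le_of_le_one_left (norm_nonneg _) hb.le

theorem setIntegral_inner_mul_windingPotential (hγ : IsSimpleClosedArcLengthCurve γ L) (e : E3) :
    IntegrableOn (fun x => inner ℝ x e * windingPotential γ L x) (Metric.ball (0 : E3) 1) ∧
    ∫ x in Metric.ball (0 : E3) 1, inner ℝ x e * windingPotential γ L x
      = poleMoment * ∫ t in 0..L, inner ℝ e (normal γ t) := by
  have hi := hγ.integrable_inner_mul_windingDensity e
  have e1 : ∀ x, inner ℝ x e * windingPotential γ L x
      = ∫ t in Ioc 0 L, inner ℝ x e * windingDensity γ x t := fun x => by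
    rw [windingPotential, intervalIntegral.integral_of_le hγ.pos.le, integral_const_mul]
  simp only [e1]
  refine ⟨hi.integral_prod_left, ?_⟩
  rw [integral_integral_swap hi, intervalIntegral.integral_of_le hγ.pos.le, ← integral_const_mul]
  congr 1
  funext t
  obtain ⟨b, hb2, hb⟩ := hγ.windingDensity_eq_poleDensity t
  simp only [hb, setIntegral_inner_mul_poleDensity, hb2]

theorem integral_inner_normal (hγ : IsSimpleClosedArcLengthCurve γ L) (e : E3) :
    ∫ t in 0..L, inner ℝ e (normal γ t) = inner ℝ e (∫ t in 0..L, normal γ t) := by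
  rw [intervalIntegral.integral_of_le hγ.pos.le, intervalIntegral.integral_of_le hγ.pos.le]
  exact integral_inner (hγ.continuous_normal.integrableOn_Ioc) e

/-- The integral of the normal of a simple closed spherical curve, that is, twice its vector
area, is bounded by a universal constant. -/
theorem norm_integral_normal_le (hγ : IsSimpleClosedArcLengthCurve γ L) :
    ‖∫ t in 0..L, normal γ t‖ ≤
      (5 + 16 * Real.pi) * volume.real (Metric.ball (0 : E3) 1) / poleMoment := by
  have hpm := poleMoment_pos
  set V := ∫ t in 0..L, normal γ t with hV
  obtain ⟨hi, he⟩ := hγ.setIntegral_inner_mul_windingPotential V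
  have hVV : ∫ t in 0..L, inner ℝ V (normal γ t) = ‖V‖ ^ 2 := by
    exact hγ.integral_inner_normal V |>.trans (real_inner_self_eq_norm_sq V)
  rw [hVV] at he
  obtain ⟨a, ha⟩ := hγ.exists_abs_windingPotential_sub_le
  have hc : IntegrableOn (fun x : E3 => inner ℝ x V * a) (Metric.ball (0 : E3) 1) :=
    integrableOn_inner_mul (integrableOn_const (by simp)) V
  have hsub : ∫ x in Metric.ball (0 : E3) 1, inner ℝ x V * (windingPotential γ L x - a)
      = poleMoment * ‖V‖ ^ 2 := by
    simp only [mul_sub]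
    rw [integral_sub hi hc, he, integral_mul_const, setIntegral_inner_eq_zero]
    ring
  have hb : ‖∫ x in Metric.ball (0 : E3) 1, inner ℝ x V * (windingPotential γ L x - a)‖
      ≤ ‖V‖ * (5 + 16 * Real.pi) * volume.real (Metric.ball (0 : E3) 1) := by
    refine norm_setIntegral_le_of_norm_le_const_ae measure_ball_lt_top ?_
    filter_upwards [ae_restrict_of_ae hγ.ae_offCone, ae_restrict_mem measurableSet_ball] with x h1 h2
    rw [mem_ball_zero_iff] at h2
    rw [norm_mul]
    refine mul_le_mul ?_ (ha x h1) (norm_nonneg _) (norm_nonneg _)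
    exact (norm_inner_le_norm x V).trans (mul_le_of_le_one_left (norm_nonneg _) h2.le)
  rw [hsub, Real.norm_of_nonneg (by positivity)] at hb
  rw [le_div_iff₀ hpm]
  rcases (norm_nonneg V).eq_or_lt with h | h
  · rw [← h, zero_mul]; positivity
  · refine le_of_mul_le_mul_left ?_ h
    linarith

end IsSimpleClosedArcLengthCurve

/-! ### The nonlocal curvature energy -/

/-- Only radii in `(1/2, 1)` are kept: there the denominator is at most `2⁴`, and it is positive
even when `x = y`. -/
theorem le_kernel {s : ℝ} (hs : 1 / 2 < s) (hs1 : s < 1) {x y : E3} (hx : ‖x‖ = 1)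
    (hy : ‖y‖ = 1) : ENNReal.ofReal (1 / 64) ≤ kernel s x y := by
  have h1 : ∀ t ∈ Ioo (1 / 2 : ℝ) 1,
      ENNReal.ofReal (1 / 32) ≤ ENNReal.ofReal (t / ‖x - t • y‖ ^ (3 + s)) := by
    intro t ht
    have ht0 : 0 < t := by linarith [ht.1]
    have hty : ‖t • y‖ = t := by rw [norm_smul, hy, mul_one, Real.norm_of_nonneg ht0.le]
    have hpos : 0 < ‖x - t • y‖ := by
      have := norm_sub_norm_le x (t • y)
      rw [hx, hty] at this
      linarith [ht.2]
    have hle : ‖x - t • y‖ ≤ 2 := by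
      have := norm_sub_le x (t • y)
      rw [hx, hty] at this
      linarith [ht.2]
    have hpow : ‖x - t • y‖ ^ (3 + s) ≤ 16 := by
      calc ‖x - t • y‖ ^ (3 + s) ≤ 2 ^ (3 + s) := by gcongr
        _ ≤ 2 ^ (4 : ℝ) := Real.rpow_le_rpow_of_exponent_le (by norm_num) (by linarith)
        _ = 16 := by norm_num
    apply ENNReal.ofReal_le_ofReal
    rw [le_div_iff₀ (Real.rpow_pos_of_pos hpos _)]
    linarith [ht.1]
  calc ENNReal.ofReal (1 / 64) = ∫⁻ _ in Ioo (1 / 2 : ℝ) 1, ENNReal.ofReal (1 / 32) := by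
        rw [setLIntegral_const, Real.volume_Ioo, ← ENNReal.ofReal_mul (by norm_num)]
        norm_num
    _ ≤ ∫⁻ t in Ioo (1 / 2 : ℝ) 1, ENNReal.ofReal (t / ‖x - t • y‖ ^ (3 + s)) :=
        setLIntegral_mono' measurableSet_Ioo h1
    _ ≤ kernel s x y := lintegral_mono_set fun t ht => lt_trans (by norm_num) ht.1

theorem setLIntegral_ofReal_eq {f : ℝ → ℝ} (hf : Continuous f) (hf0 : ∀ t, 0 ≤ f t) {L : ℝ}
    (hL : 0 ≤ L) : ∫⁻ t in Icc 0 L, ENNReal.ofReal (f t) = ENNReal.ofReal (∫ t in 0..L, f t) := by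
  rw [intervalIntegral.integral_of_le hL, ← integral_Icc_eq_integral_Ioc,
    ofReal_integral_eq_lintegral_ofReal hf.integrableOn_Icc (Eventually.of_forall hf0)]

theorem IsSimpleClosedArcLengthCurve.le_curvatureEnergy {γ : ℝ → E3} {L : ℝ}
    (hγ : IsSimpleClosedArcLengthCurve γ L) {s : ℝ} (hs : 1 / 2 < s) (hs1 : s < 1) :
    ENNReal.ofReal ((L ^ 2 - ‖∫ t in 0..L, normal γ t‖ ^ 2) / 32) ≤ curvatureEnergy s L γ := by
  have hνc := hγ.continuous_normal
  set V := ∫ t in 0..L, normal γ t with hV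
  have hin : ∀ t, ∫ u in 0..L, ‖normal γ t - normal γ u‖ ^ 2 / 64
      = L / 32 - inner ℝ V (normal γ t) / 32 := by
    intro t
    have h1 : ∀ u, ‖normal γ t - normal γ u‖ ^ 2 / 64
        = 1 / 32 - inner ℝ (normal γ t) (normal γ u) / 32 := fun u => by
      rw [norm_sub_sq_real, hγ.norm_normal, hγ.norm_normal]; ring
    simp only [h1]
    have c1 : Continuous fun u => inner ℝ (normal γ t) (normal γ u) / 32 := by fun_prop
    rw [intervalIntegral.integral_sub intervalIntegrable_const (c1.intervalIntegrable _ _),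
      intervalIntegral.integral_const, intervalIntegral.integral_div, hγ.integral_inner_normal,
      real_inner_comm, smul_eq_mul]
    ring
  have hin0 : ∀ t, 0 ≤ L / 32 - inner ℝ V (normal γ t) / 32 := fun t => by
    rw [← hin]
    exact intervalIntegral.integral_nonneg hγ.pos.le fun u _ => by positivity
  have hout : ∫ t in 0..L, (L / 32 - inner ℝ V (normal γ t) / 32) = (L ^ 2 - ‖V‖ ^ 2) / 32 := by
    have c1 : Continuous fun t => inner ℝ V (normal γ t) / 32 := by fun_prop
    rw [intervalIntegral.integral_sub intervalIntegrable_const (c1.intervalIntegrable _ _),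
      intervalIntegral.integral_const, intervalIntegral.integral_div, hγ.integral_inner_normal,
      real_inner_self_eq_norm_sq, smul_eq_mul]
    ring
  rw [← hout, ← setLIntegral_ofReal_eq (by fun_prop) hin0 hγ.pos.le, curvatureEnergy]
  refine lintegral_mono fun t => ?_
  rw [← hin, ← setLIntegral_ofReal_eq (by fun_prop) (fun u => by positivity) hγ.pos.le]
  refine lintegral_mono fun u => ?_
  rw [div_eq_mul_one_div, ENNReal.ofReal_mul (by positivity)]
  gcongr
  exact le_kernel hs hs1 (hγ.norm_eq t) (hγ.norm_eq u)

end NonlocalCurve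

end

/-! ### Conclusion -/

theorem lemma5p1 :
    ∀ C₀ : ℝ, 0 < C₀ →
      ∃ C : ℝ, ∀ (s L : ℝ) (γ : ℝ → NonlocalCurve.E3),
        1 / 2 < s → s < 1 →
        NonlocalCurve.IsSimpleClosedArcLengthCurve γ L →
        NonlocalCurve.curvatureEnergy s L γ ≤ ENNReal.ofReal (C₀ * L) →
        L ≤ C₀ / (1 - s) →
        L ≤ C := by
  intro C₀ hC₀
  refine ⟨32 * C₀ + (5 + 16 * Real.pi) * MeasureTheory.volume.real
    (Metric.ball (0 : NonlocalCurve.E3) 1) / NonlocalCurve.poleMoment, ?_⟩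
  intro s L γ hs hs1 hγ hE _
  have h1 := hγ.norm_integral_normal_le
  have h2 := (hγ.le_curvatureEnergy hs hs1).trans hE
  have hL := hγ.pos
  rw [ENNReal.ofReal_le_ofReal_iff (by positivity)] at h2
  have hV := norm_nonneg (∫ t in 0..L, NonlocalCurve.normal γ t)
  by_contra hcon
  push Not at hcon
  -- Let `K` be the bound on `‖V‖`. If `L > 32 C₀ + K`, then `L² - 32 C₀ L > K L ≥ ‖V‖²`,
  -- contradicting `h2`.
  nlinarith
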